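/- Let $1<p\le 2$ and $\lambda,\mu_{11},\mu_{12},\mu_{22}>0$. For $w\in H^1(\mathbb R^3)$ real-valued put $\phi_w(x)=\int_{\mathbb R^3}\frac{w(y)^2}{|x-y|}\,dy$. Consider the system $$(E)\quad\begin{cases}-\Delta u+\lambda u+(\mu_{11}\phi_u-\mu_{12}\phi_v)u=\dfrac1{2\pi}\displaystyle\int_0^{2\pi}|u+e^{i\theta}v|^{p-1}(u+e^{i\theta}v)\,d\theta,\\[2mm]-\Delta v+\lambda v+(\mu_{22}\phi_v-\mu_{12}\phi_u)v=\dfrac1{2\pi}\displaystyle\int_0^{2\pi}|v+e^{i\theta}u|^{p-1}(v+e^{i\theta}u)\,d\theta\end{cases}\quad\text{in }\mathbb R^3$$ for real-valued $u,v$, where a solution is a pair $(u,v)\in H^1(\mathbb R^3)\times H^1(\mathbb R^3)$ that satisfies both equations in the weak sense (tested against all functions in $C_c^\infty(\mathbb R^3)$). Suppose that $$\frac{\mu_{11}\mu_{22}-\mu_{12}^2}{\mu_{11}+\mu_{22}}>\begin{cases}\dfrac{(p-1)^2}{4}\left[\dfrac{2^p(2-p)^{2-p}}{\lambda^{2-p}}\right]^{2/(p-1)}&\text{if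 }1<p<2,\\[2mm]4&\text{if }p=2.\end{cases}$$ Then $(E)$ has only the trivial solution: $(u,v)$ is a solution of $(E)$ if and only if $u=0$ and $v=0$ almost everywhere. -/

import Mathlib

open MeasureTheory
open scoped ContDiff

noncomputable section

/-- Euclidean three-space. -/
abbrev E3 : Type := EuclideanSpace ℝ (Fin 3)

/-- Real test functions: smooth functions with compact support on three-space. -/
def IsTestFunction (η : E3 → ℝ) : Prop :=
  ContDiff ℝ ∞ η ∧ HasCompactSupport η

/-- `G` is the weak (distributional) gradient of `w`. -/
def IsWeakGradient (w : E3 → ℝ) (G : E3 → E3) : Prop :=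
  ∀ η : E3 → ℝ, IsTestFunction η → ∀ i : Fin 3,
    ∫ x, w x * fderiv ℝ η x (EuclideanSpace.single i 1) = - ∫ x, G x i * η x

/-- `w` represents an element of the Sobolev space `H¹` of three-space, and `G` represents its
weak gradient. -/
def IsH1WithGradient (w : E3 → ℝ) (G : E3 → E3) : Prop :=
  MemLp w 2 volume ∧ MemLp G 2 volume ∧ IsWeakGradient w G

/-- The Coulomb potential `φ_w(x) = ∫ w(y)² / |x - y| dy`. -/
def coulombPotential (w : E3 → ℝ) (x : E3) : ℝ :=
  ∫ y, w y ^ 2 / ‖x - y‖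

/-- The averaged power nonlinearity
`(1 / 2π) ∫_0^{2π} |a + e^{iθ} b|^{p-1} (a + e^{iθ} b) dθ`, a complex number as it is written
(it is real for real `a` and `b`, by the symmetry `θ ↦ 2π - θ`). -/
def averagedPower (p a b : ℝ) : ℂ :=
  (1 / (2 * (Real.pi : ℂ))) * ∫ θ in (0 : ℝ)..(2 * Real.pi),
    ((‖(a : ℂ) + Complex.exp (θ * Complex.I) * (b : ℂ)‖ ^ (p - 1) : ℝ) : ℂ) *
      ((a : ℂ) + Complex.exp (θ * Complex.I) * (b : ℂ))

/-- The weak form of the single equation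
`-Δu + l u + (m φ_u - k φ_v) u = (1 / 2π) ∫_0^{2π} |u + e^{iθ} v|^{p-1} (u + e^{iθ} v) dθ`,
where `G` is the weak gradient of `u`. -/
def IsWeakEquation (p l m k : ℝ) (u v : E3 → ℝ) (G : E3 → E3) : Prop :=
  ∀ η : E3 → ℝ, IsTestFunction η →
    ((∫ x, (inner ℝ (G x) (gradient η x) + l * u x * η x +
        (m * coulombPotential u x - k * coulombPotential v x) * u x * η x) : ℝ) : ℂ) =
      ∫ x, averagedPower p (u x) (v x) * (η x : ℂ)

/-- The pair `(u, v)` belongs to `H¹ × H¹` and is a weak solution of the coupled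
Schrödinger–Poisson type system. -/
def IsSolution (p l m₁₁ m₁₂ m₂₂ : ℝ) (u v : E3 → ℝ) : Prop :=
  ∃ Gu Gv : E3 → E3, IsH1WithGradient u Gu ∧ IsH1WithGradient v Gv ∧
    IsWeakEquation p l m₁₁ m₁₂ u v Gu ∧ IsWeakEquation p l m₂₂ m₁₂ v u Gv

end

/-!
Testing the two equations against `u` and `v` and adding them gives
`‖∇u‖² + ‖∇v‖² + l (‖u‖² + ‖v‖²) + m₁₁ D(u², u²) - 2 m₁₂ D(u², v²) + m₂₂ D(v², v²)
  ≤ ∫ (|u| + |v|)^(p+1)`,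
where `D(f, g) = ∬ f(x) g(y) / |x - y| dx dy` is the Coulomb energy (`coulombEnergy`).

* The form `D` is positive semidefinite. Indeed `|·|⁻² * |·|⁻² = C |·|⁻¹` (`rieszComp_eq`), so that
  `C D(f, g)` is the `L²` pairing of the Riesz potentials `f * |·|⁻²` and `g * |·|⁻²`. Hence the
  quadratic part is at least `κ (D(u², u²) + D(v², v²))`, where `κ` is the determinant
  divided by the trace.
* Averaging the fundamental theorem of calculus over all rays from `y` yields
  `4π |η(y)| ≤ ∫ |∇η(x)| / |x - y|² dx`, so that
  `4π ∫ |η| f ≤ ∫ |∇η| (f * |·|⁻²) ≤ ‖∇η‖ (C D(f, f))^(1/2)`. As `C ≤ (4π)²`, the choice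
  `f = w²` gives `(∫ |w|³)² ≤ ‖∇w‖² D(w², w²)`
  (`IsH1WithGradient.sq_integral_abs_cube_le`), and therefore
  `‖∇w‖² + κ D(w², w²) ≥ 2 √κ ∫ |w|³`.
* With `κ₀` the threshold of the theorem,
  `(|a| + |b|)^(p+1) ≤ l (a² + b²) + 2 √κ₀ (|a|³ + |b|³)` by convexity and Young's inequality
  (`add_rpow_le`).

Together these give `2 (√κ - √κ₀) ∫ (|u|³ + |v|³) ≤ 0`, so `u` and `v` vanish.

The weak formulation only admits test functions. They are dense in `H¹` (mollification and cutoff),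
and the equations pass to the limit because the coefficients are square integrable: `H¹ ⊆ L⁶` by
Sobolev's inequality, which makes the Coulomb potentials bounded and, for `p ≤ 2`, the nonlinearity
square integrable.
-/

open Set Metric Filter Topology
open scoped ENNReal Convolution

/-! ### Polar coordinates and the self-convolution of the Riesz kernel -/

/-- Integration in polar coordinates on three-space. -/
theorem lintegral_polar {f : E3 → ℝ≥0∞} (hf : Measurable f) :
    ∫⁻ x, f x = ∫⁻ σ, (∫⁻ r in Ioi (0 : ℝ), ENNReal.ofReal (r ^ 2) * f (r • (σ : E3)))
      ∂((volume : Measure E3).toSphere) := by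
  have h1 : ∫⁻ x, f x = ∫⁻ x : ({(0)}ᶜ : Set E3), f x ∂((volume : Measure E3).comap (↑)) := by
    rw [lintegral_subtype_comap (measurableSet_singleton _).compl, restrict_compl_singleton]
  have h2 := ((volume : Measure E3).measurePreserving_homeomorphUnitSphereProd).symm
    (homeomorphUnitSphereProd E3).toMeasurableEquiv
  have h3 := h2.lintegral_comp_emb (MeasurableEquiv.measurableEmbedding _)
    (fun x : ({(0)}ᶜ : Set E3) => f x)
  rw [h1, ← h3]
  have hd : Module.finrank ℝ E3 - 1 = 2 := by simp
  rw [hd, lintegral_prod]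
  · refine lintegral_congr fun σ => ?_
    rw [Measure.volumeIoiPow, lintegral_withDensity_eq_lintegral_mul]
    · rw [← lintegral_subtype_comap measurableSet_Ioi
        (fun r => ENNReal.ofReal (r ^ 2) * f (r • (σ : E3)))]
      rfl
    · fun_prop
    · refine hf.comp (Measurable.comp measurable_subtype_coe ?_)
      exact (MeasurableEquiv.measurable _).comp (by fun_prop)
  · refine (hf.comp (Measurable.comp measurable_subtype_coe ?_)).aemeasurable
    exact (MeasurableEquiv.measurable _)

theorem toSphere_univ : (volume : Measure E3).toSphere univ = ENNReal.ofReal (4 * Real.pi) := by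
  rw [Measure.toSphere_apply_univ, EuclideanSpace.volume_ball_fin_three]
  simp only [finrank_euclideanSpace, Fintype.card_fin, Nat.cast_ofNat, ENNReal.ofReal_one,
      one_pow, one_mul]
  rw [show (3 : ℝ≥0∞) = ENNReal.ofReal 3 by simp, ← ENNReal.ofReal_mul (by norm_num)]
  congr 1; ring

theorem lintegral_radial {g : ℝ → ℝ≥0∞} (hg : Measurable g) :
    ∫⁻ x : E3, g ‖x‖ = ENNReal.ofReal (4 * Real.pi) *
      ∫⁻ r in Ioi (0 : ℝ), ENNReal.ofReal (r ^ 2) * g r := by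
  rw [lintegral_polar (by fun_prop), ← toSphere_univ, mul_comm, ← lintegral_const]
  refine lintegral_congr fun σ => ?_
  refine setLIntegral_congr_fun measurableSet_Ioi fun r hr => ?_
  simp only [norm_smul, Real.norm_eq_abs, abs_of_pos (mem_Ioi.1 hr),
    mem_sphere_zero_iff_norm.1 σ.2, mul_one]

/-- The Newtonian kernel `1 / |x|`, with values in `[0, ∞]`; it equals `∞` at the origin, unlike the
real quotient, and the two are only ever compared almost everywhere. -/
noncomputable def invNorm (x : E3) : ℝ≥0∞ := ‖x‖ₑ⁻¹

@[fun_prop]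
theorem measurable_invNorm : Measurable invNorm := by unfold invNorm; fun_prop

theorem invNorm_smul {t : ℝ} (ht : t ≠ 0) (x : E3) : invNorm (t • x) = ‖t‖ₑ⁻¹ * invNorm x := by
  rw [invNorm, enorm_smul, ENNReal.mul_inv (Or.inl (by simpa)) (Or.inl (by simp)), invNorm]

theorem invNorm_neg (x : E3) : invNorm (-x) = invNorm x := by simp [invNorm]

theorem invNorm_sub_comm (x y : E3) : invNorm (x - y) = invNorm (y - x) := by
  rw [← invNorm_neg, neg_sub]

/-- The convolution `|·|⁻² * |·|⁻²` of the Riesz kernel with itself. -/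
noncomputable def rieszComp (x : E3) : ℝ≥0∞ := ∫⁻ z, invNorm z ^ 2 * invNorm (x - z) ^ 2

theorem rieszComp_isometry (L : E3 ≃ₗᵢ[ℝ] E3) (x : E3) : rieszComp (L x) = rieszComp x := by
  rw [rieszComp, ← L.measurePreserving.lintegral_comp (by fun_prop)]
  simp only [rieszComp, invNorm, ← map_sub, LinearIsometryEquiv.enorm_map]

theorem rieszComp_smul {t : ℝ} (ht : 0 < t) (x : E3) :
    rieszComp (t • x) = ‖t‖ₑ⁻¹ * rieszComp x := by
  have h : ∫⁻ z : E3, invNorm (t • z) ^ 2 * invNorm (t • x - t • z) ^ 2 =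
      ENNReal.ofReal |(t ^ Module.finrank ℝ E3)⁻¹| * rieszComp (t • x) := by
    rw [rieszComp, ← smul_eq_mul, ← lintegral_smul_measure,
      ← Measure.map_addHaar_smul (volume : Measure E3) ht.ne',
      lintegral_map (by fun_prop) (by fun_prop)]
  have h0 : ‖t‖ₑ ≠ 0 := by simpa using ht.ne'
  have h1 : ‖t‖ₑ ≠ ⊤ := by simp
  have h2 : ∀ z : E3, invNorm (t • z) ^ 2 * invNorm (t • x - t • z) ^ 2 =
      ‖t‖ₑ⁻¹ ^ 4 * (invNorm z ^ 2 * invNorm (x - z) ^ 2) := by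
    intro z
    rw [← smul_sub, invNorm_smul ht.ne', invNorm_smul ht.ne']
    ring
  simp only [h2] at h
  rw [lintegral_const_mul _ (by fun_prop)] at h
  have h3 : ENNReal.ofReal |(t ^ Module.finrank ℝ E3)⁻¹| = ‖t‖ₑ⁻¹ ^ 3 := by
    rw [finrank_euclideanSpace, Fintype.card_fin, ← Real.norm_eq_abs, ofReal_norm,
      enorm_inv (by positivity), enorm_pow, ENNReal.inv_pow]
  rw [h3] at h
  have h4 : ‖t‖ₑ⁻¹ ^ 3 * (‖t‖ₑ⁻¹ * rieszComp x) = ‖t‖ₑ⁻¹ ^ 3 * rieszComp (t • x) := by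
    rw [← mul_assoc, ← pow_succ]; exact h
  exact ((ENNReal.mul_right_inj (by simp) (by simpa using ht.ne')).1 h4).symm

/-- The constant `C` in `|·|⁻² * |·|⁻² = C / |·|`, that is, the value of the convolution at a unit
vector. -/
noncomputable def rieszConst : ℝ≥0∞ := rieszComp (EuclideanSpace.single 0 1)

/-- Up to a constant, `|·|⁻² * |·|⁻²` is the Newtonian kernel: it is invariant under isometries and
homogeneous of degree `-1`. -/
theorem rieszComp_eq {x : E3} (hx : x ≠ 0) : rieszComp x = rieszConst * invNorm x := by
  set e : E3 := EuclideanSpace.single 0 1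
  have he : ‖e‖ = 1 := by simp [e]
  have hx' : 0 < ‖x‖ := norm_pos_iff.2 hx
  have h : ‖(‖x‖⁻¹ • x)‖ = ‖e‖ := by
    rw [norm_smul, norm_inv, norm_norm, inv_mul_cancel₀ hx'.ne', he]
  have h1 := Submodule.reflection_sub h
  have h2 : x = ‖x‖ • (‖x‖⁻¹ • x) := by rw [smul_smul, mul_inv_cancel₀ hx'.ne', one_smul]
  conv_lhs => rw [h2]
  rw [rieszComp_smul hx', ← rieszComp_isometry _ (‖x‖⁻¹ • x), h1, mul_comm, enorm_norm]
  rfl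

theorem rieszConst_ne_zero : rieszConst ≠ 0 := by
  intro h
  rw [rieszConst, rieszComp, lintegral_eq_zero_iff (by fun_prop)] at h
  obtain ⟨x, hx⟩ := h.exists
  simp [invNorm] at hx

theorem lintegral_inv_sq_tail {R : ℝ} (hR : 0 < R) :
    ∫⁻ r in Ioi R, ENNReal.ofReal ((r ^ 2)⁻¹) = ENNReal.ofReal (R⁻¹) := by
  have h1 : ∀ r ∈ Ioi R, ENNReal.ofReal ((r ^ 2)⁻¹) = ENNReal.ofReal (r ^ (-2 : ℝ)) := by
    intro r hr
    have : 0 < r := hR.trans hr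
    rw [Real.rpow_neg this.le]; norm_num
  rw [setLIntegral_congr_fun measurableSet_Ioi h1,
    ← ofReal_integral_eq_lintegral_ofReal (integrableOn_Ioi_rpow_of_lt (by norm_num) hR),
    integral_Ioi_rpow_of_lt (by norm_num) hR]
  · congr 1
    norm_num
    rw [Real.rpow_neg_one]
  · filter_upwards [ae_restrict_mem measurableSet_Ioi] with r hr
    exact Real.rpow_nonneg (hR.trans hr).le _

/-- On the half-space of points `z` closer to `0` than to a unit vector `e`, with `w = e - z`, the
integrand of `rieszConst` is dominated by a radial function. -/
theorem invNorm_mul_le {z w : E3} (hzw : ‖z‖ ≤ ‖w‖) (h1 : 1 ≤ ‖z‖ + ‖w‖) (hz : z ≠ 0) :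
    invNorm z ^ 2 * invNorm w ^ 2 ≤
      if ‖z‖ ≤ 1 / 2 then 4 * ENNReal.ofReal ((‖z‖ ^ 2)⁻¹)
      else ENNReal.ofReal ((‖z‖ ^ 2)⁻¹ ^ 2) := by
  have hz' : 0 < ‖z‖ := norm_pos_iff.2 hz
  have e : ∀ y : E3, 0 < ‖y‖ → invNorm y ^ 2 = ENNReal.ofReal ((‖y‖ ^ 2)⁻¹) := by
    intro y hy
    rw [invNorm, ← ofReal_norm, ENNReal.ofReal_inv_of_pos (by positivity),
      ENNReal.ofReal_pow hy.le, ENNReal.inv_pow]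
  have hw : 0 < ‖w‖ := hz'.trans_le hzw
  rw [e z hz', e w hw, ← ENNReal.ofReal_mul (by positivity)]
  split_ifs with h
  · rw [show (4 : ℝ≥0∞) = ENNReal.ofReal 4 by simp, ← ENNReal.ofReal_mul (by norm_num)]
    apply ENNReal.ofReal_le_ofReal
    rw [mul_comm]
    gcongr
    have : 1 / 2 ≤ ‖w‖ := by linarith
    calc (‖w‖ ^ 2)⁻¹ ≤ ((1 / 2 : ℝ) ^ 2)⁻¹ := by gcongr
      _ = 4 := by norm_num
  · apply ENNReal.ofReal_le_ofReal
    rw [sq (‖z‖ ^ 2)⁻¹]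
    gcongr

theorem lintegral_majorant :
    ∫⁻ z : E3, (if ‖z‖ ≤ 1 / 2 then 4 * ENNReal.ofReal ((‖z‖ ^ 2)⁻¹)
      else ENNReal.ofReal ((‖z‖ ^ 2)⁻¹ ^ 2)) = ENNReal.ofReal (16 * Real.pi) := by
  have hm : Measurable (fun r : ℝ => if r ≤ 1 / 2 then 4 * ENNReal.ofReal ((r ^ 2)⁻¹)
      else ENNReal.ofReal ((r ^ 2)⁻¹ ^ 2)) :=
    Measurable.ite measurableSet_Iic (by fun_prop) (by fun_prop)
  rw [lintegral_radial hm]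
  have hu : Ioi (0 : ℝ) = Ioc 0 (1 / 2) ∪ Ioi (1 / 2) := (Ioc_union_Ioi_eq_Ioi (by norm_num)).symm
  rw [hu, lintegral_union measurableSet_Ioi (by
    rw [Set.disjoint_left]; intro x hx hx'; exact absurd hx.2 (not_le.2 hx'))]
  have h1 : ∫⁻ r in Ioc (0 : ℝ) (1 / 2), ENNReal.ofReal (r ^ 2) *
      (if r ≤ 1 / 2 then 4 * ENNReal.ofReal ((r ^ 2)⁻¹) else ENNReal.ofReal ((r ^ 2)⁻¹ ^ 2))
      = 2 := by
    have : ∀ r ∈ Ioc (0 : ℝ) (1 / 2), ENNReal.ofReal (r ^ 2) *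
      (if r ≤ 1 / 2 then 4 * ENNReal.ofReal ((r ^ 2)⁻¹) else ENNReal.ofReal ((r ^ 2)⁻¹ ^ 2))
        = 4 := by
      intro r hr
      have hr0 := hr.1
      rw [if_pos hr.2, mul_left_comm, ← ENNReal.ofReal_mul (by positivity),
        mul_inv_cancel₀ (by positivity)]
      simp
    rw [setLIntegral_congr_fun measurableSet_Ioc this, setLIntegral_const, Real.volume_Ioc,
      show (4 : ℝ≥0∞) = ENNReal.ofReal 4 by simp, ← ENNReal.ofReal_mul (by norm_num)]
    norm_num
  have h2 : ∫⁻ r in Ioi (1 / 2 : ℝ), ENNReal.ofReal (r ^ 2) *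
      (if r ≤ 1 / 2 then 4 * ENNReal.ofReal ((r ^ 2)⁻¹) else ENNReal.ofReal ((r ^ 2)⁻¹ ^ 2))
      = 2 := by
    have : ∀ r ∈ Ioi (1 / 2 : ℝ), ENNReal.ofReal (r ^ 2) *
      (if r ≤ 1 / 2 then 4 * ENNReal.ofReal ((r ^ 2)⁻¹) else ENNReal.ofReal ((r ^ 2)⁻¹ ^ 2)) =
        ENNReal.ofReal ((r ^ 2)⁻¹) := by
      intro r hr
      have hr0 : 0 < r := lt_trans (by norm_num) hr
      rw [if_neg (not_le.2 hr), ← ENNReal.ofReal_mul (by positivity)]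
      congr 1
      field_simp
    rw [setLIntegral_congr_fun measurableSet_Ioi this, lintegral_inv_sq_tail (by norm_num)]
    norm_num
  rw [h1, h2, show (2 + 2 : ℝ≥0∞) = ENNReal.ofReal 4 by norm_num,
    ← ENNReal.ofReal_mul (by positivity)]
  congr 1; ring

/-- A crude bound: the exact value of the constant is `π³`, and all that matters later is that it
does not exceed `(4π)²`. -/
theorem rieszConst_le : rieszConst ≤ ENNReal.ofReal (32 * Real.pi) := by
  set e : E3 := EuclideanSpace.single 0 1 with he_def
  have he : ‖e‖ = 1 := by simp [e]
  set F : E3 → ℝ≥0∞ := fun z => if ‖z‖ ≤ 1 / 2 then 4 * ENNReal.ofReal ((‖z‖ ^ 2)⁻¹)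
      else ENNReal.ofReal ((‖z‖ ^ 2)⁻¹ ^ 2) with hF
  have hFm : Measurable F :=
    Measurable.ite (measurableSet_le (by fun_prop) (by fun_prop)) (by fun_prop) (by fun_prop)
  have hle : ∀ᵐ z : E3, invNorm z ^ 2 * invNorm (e - z) ^ 2 ≤ F z + F (e - z) := by
    have hz0 : ∀ᵐ z : E3, z ≠ 0 := by
      simp [ae_iff, measure_singleton]
    have hze : ∀ᵐ z : E3, z ≠ e := by
      simp [ae_iff, measure_singleton]
    filter_upwards [hz0, hze] with z hz hz2
    have htri : 1 ≤ ‖z‖ + ‖e - z‖ := by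
      rw [← he]; simpa using norm_add_le z (e - z)
    rcases le_total ‖z‖ ‖e - z‖ with h | h
    · exact (invNorm_mul_le h htri hz).trans le_self_add
    · rw [mul_comm]
      exact (invNorm_mul_le h (by linarith) (sub_ne_zero.2 hz2.symm)).trans le_add_self
  calc rieszConst ≤ ∫⁻ z, (F z + F (e - z)) := lintegral_mono_ae hle
    _ = ENNReal.ofReal (16 * Real.pi) + ENNReal.ofReal (16 * Real.pi) := by
      rw [lintegral_add_left hFm, lintegral_sub_left_eq_self F e, lintegral_majorant]
    _ = _ := by rw [← ENNReal.ofReal_add (by positivity) (by positivity)]; congr 1; ring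

/-! ### The Coulomb energy and its pairing with test functions -/

/-- The Cauchy–Schwarz inequality in squared form. -/
theorem sq_lintegral_mul_le {α : Type*} [MeasurableSpace α] {μ : Measure α} {f g : α → ℝ≥0∞}
    (hf : AEMeasurable f μ) (hg : AEMeasurable g μ) :
    (∫⁻ x, f x * g x ∂μ) ^ 2 ≤ (∫⁻ x, f x ^ 2 ∂μ) * ∫⁻ x, g x ^ 2 ∂μ := by
  have h := ENNReal.lintegral_mul_le_Lp_mul_Lq μ (p := 2) (q := 2) (by
    constructor <;> norm_num) hf hg
  simp only [ENNReal.rpow_two, Pi.mul_apply] at h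
  calc (∫⁻ x, f x * g x ∂μ) ^ 2
      ≤ ((∫⁻ x, f x ^ 2 ∂μ) ^ (1 / 2 : ℝ) * (∫⁻ x, g x ^ 2 ∂μ) ^ (1 / 2 : ℝ)) ^ 2 := by gcongr
    _ = _ := by
      rw [mul_pow, ← ENNReal.rpow_two, ← ENNReal.rpow_two, ← ENNReal.rpow_mul, ← ENNReal.rpow_mul]
      norm_num

/-- The Coulomb energy `∬ f(x) g(y) / |x - y| dx dy` of two nonnegative densities. -/
noncomputable def coulombEnergy (f g : E3 → ℝ≥0∞) : ℝ≥0∞ :=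
  ∫⁻ x, ∫⁻ y, f x * g y * invNorm (x - y)

/-- The Riesz potential `f * |·|⁻²` of a nonnegative density. -/
noncomputable def rieszPotential (f : E3 → ℝ≥0∞) (z : E3) : ℝ≥0∞ :=
  ∫⁻ y, f y * invNorm (y - z) ^ 2

theorem measurable_rieszPotential {f : E3 → ℝ≥0∞} (hf : Measurable f) :
    Measurable (rieszPotential f) := by
  unfold rieszPotential
  exact Measurable.lintegral_prod_right' (f := fun q : E3 × E3 => f q.2 * invNorm (q.2 - q.1) ^ 2)
    (by fun_prop)

theorem lintegral_invNorm_sq_mul (x y : E3) :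
    ∫⁻ z, invNorm (x - z) ^ 2 * invNorm (y - z) ^ 2 = rieszComp (x - y) := by
  rw [rieszComp, ← lintegral_sub_left_eq_self _ x]
  refine lintegral_congr fun z => ?_
  rw [sub_sub_cancel, ← invNorm_neg (y - (x - z))]
  congr 3; abel

/-- The Coulomb energy is, up to a positive constant, the `L²` pairing of the Riesz potentials. -/
theorem rieszConst_mul_coulombEnergy {f g : E3 → ℝ≥0∞} (hf : Measurable f) (hg : Measurable g) :
    rieszConst * coulombEnergy f g = ∫⁻ z, rieszPotential f z * rieszPotential g z := by
  have h1 : ∀ z, rieszPotential f z * rieszPotential g z =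
      ∫⁻ x, ∫⁻ y, f x * g y * (invNorm (x - z) ^ 2 * invNorm (y - z) ^ 2) := by
    intro z
    rw [rieszPotential, ← lintegral_mul_const _ (by fun_prop)]
    refine lintegral_congr fun x => ?_
    rw [rieszPotential, ← lintegral_const_mul _ (by fun_prop)]
    refine lintegral_congr fun y => ?_
    ring
  simp_rw [h1]
  have hm : Measurable fun q : (E3 × E3) × E3 =>
      f q.1.2 * g q.2 * (invNorm (q.1.2 - q.1.1) ^ 2 * invNorm (q.2 - q.1.1) ^ 2) := by fun_prop
  rw [lintegral_lintegral_swap hm.lintegral_prod_right'.aemeasurable, coulombEnergy,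
    ← lintegral_const_mul _ (Measurable.lintegral_prod_right'
      (f := fun q : E3 × E3 => f q.1 * g q.2 * invNorm (q.1 - q.2)) (by fun_prop))]
  refine lintegral_congr fun x => ?_
  rw [lintegral_lintegral_swap (Measurable.aemeasurable (by fun_prop)),
    ← lintegral_const_mul _ (by fun_prop)]
  refine lintegral_congr_ae ?_
  have hy : ∀ᵐ y : E3, y ≠ x := by simp [ae_iff, measure_singleton]
  filter_upwards [hy] with y hy
  rw [lintegral_const_mul _ (by fun_prop), lintegral_invNorm_sq_mul,
    rieszComp_eq (sub_ne_zero.2 hy.symm)]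
  ring

theorem rieszConst_ne_top : rieszConst ≠ ⊤ :=
  ne_top_of_le_ne_top ENNReal.ofReal_ne_top rieszConst_le

/-- The Coulomb energy is a positive semidefinite form on nonnegative densities. -/
theorem coulombEnergy_sq_le {f g : E3 → ℝ≥0∞} (hf : Measurable f) (hg : Measurable g) :
    coulombEnergy f g ^ 2 ≤ coulombEnergy f f * coulombEnergy g g := by
  have h := sq_lintegral_mul_le (μ := volume) (measurable_rieszPotential hf).aemeasurable
    (measurable_rieszPotential hg).aemeasurable
  simp only [sq (rieszPotential _ _)] at h
  rw [← rieszConst_mul_coulombEnergy hf hg, ← rieszConst_mul_coulombEnergy hf hf,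
    ← rieszConst_mul_coulombEnergy hg hg, mul_pow, mul_mul_mul_comm, ← sq] at h
  exact (ENNReal.mul_le_mul_iff_right (pow_ne_zero 2 rieszConst_ne_zero)
    (ENNReal.pow_ne_top rieszConst_ne_top)).1 h

/-- The fundamental theorem of calculus along a ray that leaves the support of `η`. -/
theorem enorm_le_lintegral_ray {η : E3 → ℝ} (hη : ContDiff ℝ 1 η) (hc : HasCompactSupport η)
    (y σ : E3) (hσ : ‖σ‖ = 1) :
    ‖η y‖ₑ ≤ ∫⁻ r in Ioi (0 : ℝ), ‖fderiv ℝ η (y + r • σ)‖ₑ := by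
  obtain ⟨R, hR⟩ := hc.isCompact.isBounded.subset_ball y
  set T : ℝ := max R 0 with hT
  have hT0 : 0 ≤ T := le_max_right _ _
  have hηT : η (y + T • σ) = 0 := by
    by_contra h
    have := hR (subset_tsupport _ (Function.mem_support.2 h))
    rw [mem_ball, dist_eq_norm, add_sub_cancel_left, norm_smul, hσ, mul_one,
      Real.norm_of_nonneg hT0] at this
    exact absurd this (not_lt.2 (le_max_left _ _))
  have hd : ∀ r : ℝ, HasDerivAt (fun r : ℝ => η (y + r • σ)) (fderiv ℝ η (y + r • σ) σ) r := by
    intro r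
    have h1 : HasDerivAt (fun r : ℝ => y + r • σ) σ r := by
      simpa using ((hasDerivAt_id r).smul_const σ).const_add y
    exact ((hη.differentiable one_ne_zero _).hasFDerivAt).comp_hasDerivAt r h1
  have hcont : Continuous fun r : ℝ => fderiv ℝ η (y + r • σ) σ := by
    have := hη.continuous_fderiv one_ne_zero
    fun_prop
  have hftc := intervalIntegral.integral_eq_sub_of_hasDerivAt (a := 0) (b := T) (fun r _ => hd r)
    (hcont.intervalIntegrable _ _)
  rw [hηT, zero_smul, add_zero, zero_sub, intervalIntegral.integral_of_le hT0] at hftc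
  calc ‖η y‖ₑ = ‖-η y‖ₑ := (enorm_neg _).symm
    _ ≤ ∫⁻ r in Ioc 0 T, ‖fderiv ℝ η (y + r • σ) σ‖ₑ := by
      rw [← hftc]; exact enorm_integral_le_lintegral_enorm _
    _ ≤ ∫⁻ r in Ioc 0 T, ‖fderiv ℝ η (y + r • σ)‖ₑ := by
      refine lintegral_mono fun r => ?_
      have := (fderiv ℝ η (y + r • σ)).le_opNorm σ
      rw [hσ, mul_one] at this
      exact enorm_le_iff_norm_le.2 this
    _ ≤ _ := lintegral_mono_set Ioc_subset_Ioi_self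

/-- The pointwise bound `4π |η(y)| ≤ ∫ |∇η(x)| / |x - y|² dx`, the average of the bounds along all
rays from `y`. -/
theorem four_pi_mul_enorm_le {η : E3 → ℝ} (hη : ContDiff ℝ 1 η) (hc : HasCompactSupport η)
    (y : E3) :
    ENNReal.ofReal (4 * Real.pi) * ‖η y‖ₑ ≤ ∫⁻ x, ‖fderiv ℝ η x‖ₑ * invNorm (x - y) ^ 2 := by
  have hcont := hη.continuous_fderiv one_ne_zero
  rw [← lintegral_add_left_eq_self _ y, lintegral_polar (by fun_prop), ← toSphere_univ, mul_comm,
    ← lintegral_const]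
  refine lintegral_mono fun σ => ?_
  have hσ : ‖(σ : E3)‖ = 1 := mem_sphere_zero_iff_norm.1 σ.2
  refine (enorm_le_lintegral_ray hη hc y σ hσ).trans_eq ?_
  refine setLIntegral_congr_fun measurableSet_Ioi fun r hr => ?_
  have hr' : r ≠ 0 := (mem_Ioi.1 hr).ne'
  have h1 : invNorm (σ : E3) = 1 := by rw [invNorm, ← ofReal_norm, hσ]; simp
  have h2 : ENNReal.ofReal (r ^ 2) = ‖r‖ₑ ^ 2 := by
    rw [ENNReal.ofReal_pow (mem_Ioi.1 hr).le, Real.enorm_of_nonneg (mem_Ioi.1 hr).le]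
  rw [add_sub_cancel_left, invNorm_smul hr', h1, h2, mul_one, mul_left_comm, ← mul_pow,
    ENNReal.mul_inv_cancel (by simpa) (by simp), one_pow, mul_one]

/-- A density is controlled against `η` by its Coulomb energy and the Dirichlet integral of `η`. The
constant `1` is not optimal; it absorbs `rieszConst ≤ (4π)²`. -/
theorem sq_lintegral_enorm_mul_le {η : E3 → ℝ} (hη : ContDiff ℝ 1 η) (hc : HasCompactSupport η)
    {f : E3 → ℝ≥0∞} (hf : Measurable f) :
    (∫⁻ x, ‖η x‖ₑ * f x) ^ 2 ≤ (∫⁻ x, ‖fderiv ℝ η x‖ₑ ^ 2) * coulombEnergy f f := by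
  have hcont := hη.continuous_fderiv one_ne_zero
  have hcont' := hη.continuous
  have h1 : ENNReal.ofReal (4 * Real.pi) * ∫⁻ x, ‖η x‖ₑ * f x ≤
      ∫⁻ x, ‖fderiv ℝ η x‖ₑ * rieszPotential f x := by
    calc ENNReal.ofReal (4 * Real.pi) * ∫⁻ x, ‖η x‖ₑ * f x
        = ∫⁻ y, (ENNReal.ofReal (4 * Real.pi) * ‖η y‖ₑ) * f y := by
          rw [← lintegral_const_mul _ (by fun_prop)]; simp only [mul_assoc]
      _ ≤ ∫⁻ y, (∫⁻ x, ‖fderiv ℝ η x‖ₑ * invNorm (x - y) ^ 2) * f y := by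
          gcongr with y; exact four_pi_mul_enorm_le hη hc y
      _ = ∫⁻ y, ∫⁻ x, ‖fderiv ℝ η x‖ₑ * invNorm (x - y) ^ 2 * f y := by
          refine lintegral_congr fun y => ?_
          rw [lintegral_mul_const _ (by fun_prop)]
      _ = ∫⁻ x, ∫⁻ y, ‖fderiv ℝ η x‖ₑ * invNorm (x - y) ^ 2 * f y :=
          lintegral_lintegral_swap (Measurable.aemeasurable (by fun_prop))
      _ = _ := by
          refine lintegral_congr fun x => ?_
          rw [rieszPotential, ← lintegral_const_mul _ (by fun_prop)]
          refine lintegral_congr fun y => ?_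
          rw [invNorm_sub_comm]; ring
  have h2 : (∫⁻ x, ‖fderiv ℝ η x‖ₑ * rieszPotential f x) ^ 2 ≤
      (∫⁻ x, ‖fderiv ℝ η x‖ₑ ^ 2) * (rieszConst * coulombEnergy f f) := by
    rw [rieszConst_mul_coulombEnergy hf hf]
    simp only [← sq (rieszPotential _ _)]
    exact sq_lintegral_mul_le (by fun_prop) (measurable_rieszPotential hf).aemeasurable
  have h3 : rieszConst ≤ ENNReal.ofReal (4 * Real.pi) ^ 2 := by
    refine rieszConst_le.trans ?_
    rw [← ENNReal.ofReal_pow (by positivity)]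
    apply ENNReal.ofReal_le_ofReal
    nlinarith [Real.pi_gt_three]
  have h4 : ENNReal.ofReal (4 * Real.pi) ^ 2 * (∫⁻ x, ‖η x‖ₑ * f x) ^ 2 ≤
      ENNReal.ofReal (4 * Real.pi) ^ 2 * ((∫⁻ x, ‖fderiv ℝ η x‖ₑ ^ 2) * coulombEnergy f f) := by
    rw [← mul_pow]
    calc _ ≤ (∫⁻ x, ‖fderiv ℝ η x‖ₑ * rieszPotential f x) ^ 2 := by gcongr
      _ ≤ _ := h2
      _ ≤ (∫⁻ x, ‖fderiv ℝ η x‖ₑ ^ 2) * (ENNReal.ofReal (4 * Real.pi) ^ 2 * coulombEnergy f f) := by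
        gcongr
      _ = _ := by ring
  refine (ENNReal.mul_le_mul_iff_right (pow_ne_zero 2 ?_)
      (ENNReal.pow_ne_top ENNReal.ofReal_ne_top)).1 h4
  simp [Real.pi_pos]

/-! ### Mollification in `L²` -/

theorem eLpNorm_two_sq {α F : Type*} [MeasurableSpace α] [NormedAddCommGroup F] (μ : Measure α)
    (f : α → F) : eLpNorm f 2 μ ^ 2 = ∫⁻ x, ‖f x‖ₑ ^ 2 ∂μ := by
  have h := eLpNorm_nnreal_pow_eq_lintegral (μ := μ) (f := f) (p := 2) (by norm_num)
  have e : ((2 : NNReal) : ℝ) = (2 : ℝ) := by norm_num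
  rw [e] at h
  simpa [ENNReal.rpow_two] using h

theorem MeasureTheory.MemLp.lintegral_enorm_sq_lt_top {α F : Type*} [MeasurableSpace α]
    [NormedAddCommGroup F] {μ : Measure α} {f : α → F} (hf : MemLp f 2 μ) :
    ∫⁻ x, ‖f x‖ₑ ^ 2 ∂μ < ⊤ := by
  rw [← eLpNorm_two_sq]; exact ENNReal.pow_lt_top hf.2

theorem memLp_two_of_lintegral_enorm_sq_lt_top {α F : Type*} [MeasurableSpace α]
    [NormedAddCommGroup F] {μ : Measure α} {f : α → F} (hm : AEStronglyMeasurable f μ)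
    (hf : ∫⁻ x, ‖f x‖ₑ ^ 2 ∂μ < ⊤) : MemLp f 2 μ := by
  rw [← eLpNorm_two_sq] at hf
  exact ⟨hm, by by_contra h; simp [top_le_iff.1 (not_lt.1 h)] at hf⟩

theorem gradient_apply (f : E3 → ℝ) (x : E3) (i : Fin 3) :
    gradient f x i = fderiv ℝ f x (EuclideanSpace.single i 1) := by
  rw [← toDual_gradient, InnerProductSpace.toDual_apply_apply, EuclideanSpace.inner_single_right]
  simp

theorem continuous_gradient {f : E3 → ℝ} (hf : ContDiff ℝ 1 f) : Continuous (gradient f) :=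
  (InnerProductSpace.toDual ℝ E3).symm.continuous.comp (hf.continuous_fderiv one_ne_zero)

/-- Translations act continuously on `L²`. -/
theorem tendsto_lintegral_translate_sub {F : Type*} [NormedAddCommGroup F] {g : E3 → F}
    (hg : MemLp g 2 volume) :
    Tendsto (fun y : E3 => ∫⁻ x, ‖g (x - y) - g x‖ₑ ^ 2) (𝓝 0) (𝓝 0) := by
  let τ : E3 → C(E3, E3) := fun y => ⟨fun x => x - y, by fun_prop⟩
  have hcont : Continuous τ :=
    (⟨fun q : E3 × E3 => q.2 - q.1, by fun_prop⟩ : C(E3 × E3, E3)).curry.continuous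
  have hmp : ∀ y : E3, MeasurePreserving (τ y) volume volume := fun y =>
    measurePreserving_sub_right volume y
  have h := (continuous_const (y := hg.toLp g)).compMeasurePreservingLp hcont hmp (by norm_num)
  have h0 := (tendsto_iff_edist_tendsto_0.1 (h.tendsto 0))
  have h1 : ∀ y, edist (Lp.compMeasurePreserving _ (hmp y) (hg.toLp g))
      (Lp.compMeasurePreserving _ (hmp 0) (hg.toLp g)) =
        eLpNorm (fun x => g (x - y) - g x) 2 volume := by
    intro y
    rw [Lp.toLp_compMeasurePreserving, Lp.toLp_compMeasurePreserving, Lp.edist_toLp_toLp]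
    congr 1
    ext x
    simp [τ]
  simp only [h1] at h0
  have h2 := ((ENNReal.continuous_pow 2).tendsto 0).comp h0
  simpa only [Function.comp_def, eLpNorm_two_sq, ne_eq, OfNat.ofNat_ne_zero, not_false_eq_true,
      zero_pow] using h2

/-- By Jensen's inequality, mollifying `g` by `ρ` moves it in `L²` no further than the translations
by vectors in the support of `ρ` do. -/
theorem lintegral_convolution_sub_le {F : Type*} [NormedAddCommGroup F] [NormedSpace ℝ F]
    [CompleteSpace F]
    {ρ : E3 → ℝ} (hρc : Continuous ρ) (hρs : HasCompactSupport ρ) (hρ0 : ∀ x, 0 ≤ ρ x)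
    (hρ1 : ∫ x, ρ x = 1) {g : E3 → F} (hg : StronglyMeasurable g) (hgl : LocallyIntegrable g volume)
    {ε : ℝ≥0∞} (hε : ∀ y, ρ y ≠ 0 → ∫⁻ x, ‖g (x - y) - g x‖ₑ ^ 2 ≤ ε) :
    ∫⁻ x, ‖(ρ ⋆[ContinuousLinearMap.lsmul ℝ ℝ, volume] g) x - g x‖ₑ ^ 2 ≤ ε := by
  have hint : ∫⁻ y, ‖ρ y‖ₑ = 1 := by
    have := ofReal_integral_eq_lintegral_ofReal (μ := volume)
      (hρc.integrable_of_hasCompactSupport hρs)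
      (ae_of_all _ hρ0)
    rw [hρ1, ENNReal.ofReal_one] at this
    rw [this]
    simp only [Real.enorm_of_nonneg (hρ0 _)]
  have hgm : Measurable fun q : E3 × E3 => ‖g (q.1 - q.2) - g q.1‖ₑ := by
    have h1 : StronglyMeasurable fun q : E3 × E3 => g (q.1 - q.2) :=
      hg.comp_measurable (by fun_prop)
    have h2 : StronglyMeasurable fun q : E3 × E3 => g q.1 := hg.comp_measurable (by fun_prop)
    exact (h1.sub h2).enorm
  have hρm : Measurable ρ := hρc.measurable
  have hpt : ∀ x, ‖(ρ ⋆[ContinuousLinearMap.lsmul ℝ ℝ, volume] g) x - g x‖ₑ ^ 2 ≤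
      ∫⁻ y, ‖ρ y‖ₑ * ‖g (x - y) - g x‖ₑ ^ 2 := by
    intro x
    have hi : Integrable (fun y => ρ y • g (x - y)) volume := by
      have := hρs.convolutionExists_left (ContinuousLinearMap.lsmul ℝ ℝ) hρc hgl x
      simpa [ConvolutionExistsAt] using this
    have hi2 : Integrable (fun y => ρ y • g x) volume :=
      (hρc.integrable_of_hasCompactSupport hρs).smul_const _
    have h1 : (ρ ⋆[ContinuousLinearMap.lsmul ℝ ℝ, volume] g) x - g x =
        ∫ y, ρ y • (g (x - y) - g x) := by
      simp only [smul_sub]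
      rw [integral_sub hi hi2, integral_smul_const, hρ1, one_smul, convolution_def]
      simp
    have hgx : Measurable fun y => ‖g (x - y) - g x‖ₑ := hgm.comp (measurable_prodMk_left (x := x))
    calc _ ≤ (∫⁻ y, ‖ρ y‖ₑ * ‖g (x - y) - g x‖ₑ) ^ 2 := by
          rw [h1]
          gcongr
          refine (enorm_integral_le_lintegral_enorm _).trans_eq ?_
          simp only [enorm_smul]
      -- Cauchy–Schwarz for the probability density `ρ`
      _ = (∫⁻ y, ‖ρ y‖ₑ ^ (1 / 2 : ℝ) * (‖ρ y‖ₑ ^ (1 / 2 : ℝ) * ‖g (x - y) - g x‖ₑ)) ^ 2 := by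
          congr 1
          refine lintegral_congr fun y => ?_
          rw [← mul_assoc, ← ENNReal.rpow_add_of_nonneg _ _ (by norm_num) (by norm_num)]
          norm_num
      _ ≤ (∫⁻ y, (‖ρ y‖ₑ ^ (1 / 2 : ℝ)) ^ 2) *
          ∫⁻ y, (‖ρ y‖ₑ ^ (1 / 2 : ℝ) * ‖g (x - y) - g x‖ₑ) ^ 2 :=
          sq_lintegral_mul_le (by fun_prop) (by fun_prop)
      _ = _ := by
          simp only [mul_pow, ← ENNReal.rpow_two, ← ENNReal.rpow_mul]
          norm_num [hint]
  calc _ ≤ ∫⁻ x, ∫⁻ y, ‖ρ y‖ₑ * ‖g (x - y) - g x‖ₑ ^ 2 := lintegral_mono hpt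
    _ = ∫⁻ y, ∫⁻ x, ‖ρ y‖ₑ * ‖g (x - y) - g x‖ₑ ^ 2 :=
      lintegral_lintegral_swap (Measurable.aemeasurable
        ((hρm.comp measurable_snd).enorm.mul (hgm.pow_const 2)))
    _ ≤ ∫⁻ y, ‖ρ y‖ₑ * ε := by
      refine lintegral_mono fun y => ?_
      have hgy : Measurable fun x => ‖g (x - y) - g x‖ₑ :=
        hgm.comp (measurable_prodMk_right (y := y))
      rw [lintegral_const_mul _ (hgy.pow_const 2)]
      by_cases hy : ρ y = 0
      · simp [hy]
      · gcongr; exact hε y hy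
    _ = ε := by rw [lintegral_mul_const _ (by fun_prop), hint, one_mul]

/-- The gradient of a mollified function is the mollified weak gradient: test the weak gradient
against `y ↦ ρ (x - y)`. -/
theorem gradient_convolution {ρ w : E3 → ℝ} {G : E3 → E3} (hρ : IsTestFunction ρ)
    (hw : LocallyIntegrable w volume) (hG : LocallyIntegrable G volume) (hwG : IsWeakGradient w G)
    (x : E3) :
    gradient (ρ ⋆[ContinuousLinearMap.lsmul ℝ ℝ, volume] w) x =
      (ρ ⋆[ContinuousLinearMap.lsmul ℝ ℝ, volume] G) x := by
  ext i
  have hd := hρ.2.hasFDerivAt_convolution_left (ContinuousLinearMap.lsmul ℝ ℝ)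
    (hρ.1.of_le (by exact_mod_cast le_top)) hw x
  have hex : ConvolutionExistsAt (fderiv ℝ ρ) w x
      ((ContinuousLinearMap.lsmul ℝ ℝ).precompL E3 : (E3 →L[ℝ] ℝ) →L[ℝ] ℝ →L[ℝ] (E3 →L[ℝ] ℝ))
          volume :=
    (hρ.2.fderiv ℝ).convolutionExists_left _ (hρ.1.continuous_fderiv (by simp)) hw x
  have hexG : ConvolutionExistsAt ρ G x (ContinuousLinearMap.lsmul ℝ ℝ) volume :=
    hρ.2.convolutionExists_left _ hρ.1.continuous hG x
  rw [gradient_apply, hd.fderiv, convolution_def, ContinuousLinearMap.integral_apply hex,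
    convolution_def]
  have e1 : (∫ t, (ContinuousLinearMap.lsmul ℝ ℝ) (ρ t) (G (x - t))).ofLp i =
      ∫ t, ρ t * (G (x - t)) i := by
    have := (EuclideanSpace.proj (𝕜 := ℝ) i : E3 →L[ℝ] ℝ).integral_comp_comm hexG
    simpa using this.symm
  rw [e1]
  have hη : IsTestFunction (fun y => ρ (x - y)) := by
    refine ⟨hρ.1.comp (contDiff_const.sub contDiff_id), ?_⟩
    exact hρ.2.comp_homeomorph (Homeomorph.subLeft x)
  have hfd : ∀ y, fderiv ℝ (fun y => ρ (x - y)) y (EuclideanSpace.single i 1) =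
      - fderiv ℝ ρ (x - y) (EuclideanSpace.single i 1) := by
    intro y
    have h1 : HasFDerivAt (fun y : E3 => x - y) (-ContinuousLinearMap.id ℝ E3) y :=
      (hasFDerivAt_id y).const_sub x
    have h2 := ((hρ.1.differentiable (by simp) (x - y)).hasFDerivAt).comp y h1
    have h3 : fderiv ℝ (fun y => ρ (x - y)) y =
        (fderiv ℝ ρ (x - y)).comp (-ContinuousLinearMap.id ℝ E3) :=
      h2.fderiv
    rw [h3]; simp
  have key := hwG _ hη i
  simp only [hfd] at key
  rw [← integral_sub_left_eq_self (fun t => ρ t * (G (x - t)) i) volume x,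
    ← integral_sub_left_eq_self _ volume x]
  simp only [sub_sub_cancel, mul_neg, integral_neg, neg_inj] at key ⊢
  rw [show (fun y => ρ (x - y) * (G y) i) = fun y => (G y) i * ρ (x - y) by ext; ring, ← key]
  refine integral_congr_ae (ae_of_all _ fun y => ?_)
  simp [ContinuousLinearMap.precompL_apply, mul_comm]

/-! ### Density of test functions in `H¹` -/

theorem IsH1WithGradient.congr {w w' : E3 → ℝ} {G G' : E3 → E3} (h : IsH1WithGradient w G)
    (hw : w =ᵐ[volume] w') (hG : G =ᵐ[volume] G') : IsH1WithGradient w' G' := by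
  refine ⟨h.1.ae_eq hw, h.2.1.ae_eq hG, fun η hη i => ?_⟩
  have e1 : ∫ x, w' x * fderiv ℝ η x (EuclideanSpace.single i 1) =
      ∫ x, w x * fderiv ℝ η x (EuclideanSpace.single i 1) :=
    integral_congr_ae (by filter_upwards [hw] with x hx; rw [hx])
  have e2 : ∫ x, G' x i * η x = ∫ x, G x i * η x :=
    integral_congr_ae (by filter_upwards [hG] with x hx; rw [hx])
  rw [e1, e2]
  exact h.2.2 η hη i

theorem lintegral_enorm_sub_sq_le {α F : Type*} [MeasurableSpace α] [NormedAddCommGroup F]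
    {μ : Measure α} {f g h : α → F} (hgh : AEStronglyMeasurable (fun x => g x - h x) μ) :
    ∫⁻ x, ‖f x - h x‖ₑ ^ 2 ∂μ ≤
      2 * ∫⁻ x, ‖f x - g x‖ₑ ^ 2 ∂μ + 2 * ∫⁻ x, ‖g x - h x‖ₑ ^ 2 ∂μ := by
  have hpt : ∀ x, ‖f x - h x‖ₑ ^ 2 ≤ 2 * ‖f x - g x‖ₑ ^ 2 + 2 * ‖g x - h x‖ₑ ^ 2 := by
    intro x
    have h1 : ‖f x - h x‖ₑ ≤ ‖f x - g x‖ₑ + ‖g x - h x‖ₑ := by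
      rw [← sub_add_sub_cancel (f x) (g x) (h x)]; exact enorm_add_le _ _
    have h2 := ENNReal.rpow_add_le_mul_rpow_add_rpow ‖f x - g x‖ₑ ‖g x - h x‖ₑ (p := 2)
        (by norm_num)
    have e : (2 : ℝ≥0∞) ^ ((2 : ℝ) - 1) = 2 := by norm_num
    rw [e, ENNReal.rpow_two, ENNReal.rpow_two, ENNReal.rpow_two, mul_add] at h2
    exact (pow_le_pow_left' h1 2).trans h2
  refine (lintegral_mono hpt).trans_eq ?_
  rw [lintegral_add_right' _ ((hgh.enorm.pow_const 2).const_mul 2),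
    lintegral_const_mul' _ _ (by norm_num), lintegral_const_mul' _ _ (by norm_num)]

/-- Approximation in `H¹` by smooth functions, by mollification. -/
theorem exists_smooth_approx {w : E3 → ℝ} {G : E3 → E3} (h : IsH1WithGradient w G) {ε : ℝ≥0∞}
    (hε : 0 < ε) : ∃ W : E3 → ℝ, ContDiff ℝ ∞ W ∧ ∫⁻ x, ‖W x - w x‖ₑ ^ 2 ≤ ε ∧
      ∫⁻ x, ‖gradient W x - G x‖ₑ ^ 2 ≤ ε := by
  have hwm := h.1.1
  have hGm := h.2.1.1
  have h' := h.congr hwm.ae_eq_mk hGm.ae_eq_mk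
  have ew : ∀ W : E3 → ℝ, ∫⁻ x, ‖W x - w x‖ₑ ^ 2 = ∫⁻ x, ‖W x - hwm.mk w x‖ₑ ^ 2 := fun W =>
    lintegral_congr_ae (by filter_upwards [hwm.ae_eq_mk] with x hx; rw [hx])
  have eG : ∀ W : E3 → E3, ∫⁻ x, ‖W x - G x‖ₑ ^ 2 = ∫⁻ x, ‖W x - hGm.mk G x‖ₑ ^ 2 := fun W =>
    lintegral_congr_ae (by filter_upwards [hGm.ae_eq_mk] with x hx; rw [hx])
  have h1 := (tendsto_lintegral_translate_sub h'.1).eventually (ge_mem_nhds hε)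
  have h2 := (tendsto_lintegral_translate_sub h'.2.1).eventually (ge_mem_nhds hε)
  obtain ⟨δ, hδ, hball⟩ := Metric.eventually_nhds_iff_ball.1 (h1.and h2)
  let φ : ContDiffBump (0 : E3) := ⟨δ / 2, δ, by positivity, by linarith⟩
  have hφ : IsTestFunction (φ.normed volume) := ⟨φ.contDiff_normed, φ.hasCompactSupport_normed⟩
  have hlw := h'.1.locallyIntegrable (by norm_num)
  have hlG := h'.2.1.locallyIntegrable (by norm_num)
  have hsupp : ∀ y, φ.normed volume y ≠ 0 → y ∈ ball (0 : E3) δ := by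
    intro y hy
    have := φ.support_normed_eq (μ := volume) ▸ Function.mem_support.2 hy
    exact this
  refine ⟨φ.normed volume ⋆[ContinuousLinearMap.lsmul ℝ ℝ, volume] hwm.mk w,
    hφ.2.contDiff_convolution_left _ hφ.1 hlw, ?_, ?_⟩
  · rw [ew]
    exact lintegral_convolution_sub_le hφ.1.continuous hφ.2 φ.nonneg_normed φ.integral_normed
      hwm.stronglyMeasurable_mk hlw fun y hy => (hball y (hsupp y hy)).1
  · rw [eG]
    simp only [gradient_convolution hφ hlw hlG h'.2.2]
    exact lintegral_convolution_sub_le hφ.1.continuous hφ.2 φ.nonneg_normed φ.integral_normed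
      hGm.stronglyMeasurable_mk hlG fun y hy => (hball y (hsupp y hy)).2

/-- A smooth function in `H¹` is approximated by test functions, by multiplication with the cutoffs
`χ (x / (n + 1))`, whose gradients are bounded uniformly in `n`. -/
theorem exists_testFunction_approx_of_smooth {W : E3 → ℝ} (hW : ContDiff ℝ ∞ W)
    (hW2 : MemLp W 2 volume) (hG2 : MemLp (gradient W) 2 volume) {ε : ℝ≥0∞} (hε : 0 < ε) :
    ∃ η : E3 → ℝ, IsTestFunction η ∧ ∫⁻ x, ‖η x - W x‖ₑ ^ 2 ≤ ε ∧
      ∫⁻ x, ‖gradient η x - gradient W x‖ₑ ^ 2 ≤ ε := by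
  let χ : ContDiffBump (0 : E3) := ⟨1, 2, by norm_num, by norm_num⟩
  have hχ : ContDiff ℝ ∞ χ := χ.contDiff
  have hχs : HasCompactSupport χ := χ.hasCompactSupport
  obtain ⟨K, hK⟩ := (hχ.continuous_fderiv (by simp)).bounded_above_of_compact_support (hχs.fderiv ℝ)
  have hK0 : 0 ≤ K := (norm_nonneg _).trans (hK 0)
  let c : ℕ → ℝ := fun n => ((n : ℝ) + 1)⁻¹
  have hc0 : ∀ n, 0 < c n := fun n => by positivity
  have hc1 : ∀ n, c n ≤ 1 := fun n => inv_le_one_of_one_le₀ (by simp)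
  have hct : Tendsto c atTop (𝓝 0) := by
    simpa [c, one_div] using tendsto_one_div_add_atTop_nhds_zero_nat (𝕜 := ℝ)
  let ψ : ℕ → E3 → ℝ := fun n x => χ (c n • x)
  let η : ℕ → E3 → ℝ := fun n x => ψ n x * W x
  have hψ : ∀ n, ContDiff ℝ ∞ (ψ n) := fun n => hχ.comp (contDiff_const_smul _)
  have hη : ∀ n, IsTestFunction (η n) := by
    intro n
    refine ⟨(hψ n).mul hW, HasCompactSupport.mul_right ?_⟩
    exact hχs.comp_homeomorph (Homeomorph.smulOfNeZero (c n) (hc0 n).ne')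
  have hψ01 : ∀ n x, 0 ≤ ψ n x ∧ ψ n x ≤ 1 := fun n x => ⟨χ.nonneg, χ.le_one⟩
  have hψd : ∀ n x, HasFDerivAt (ψ n) (c n • fderiv ℝ χ (c n • x)) x := by
    intro n x
    have h1 : HasFDerivAt (fun x : E3 => c n • x) (c n • ContinuousLinearMap.id ℝ E3) x :=
      (hasFDerivAt_id x).const_smul (c n)
    have h2 := ((hχ.differentiable (by simp) (c n • x)).hasFDerivAt).comp x h1
    refine h2.congr_fderiv ?_
    ext v; simp
  have hψg : ∀ n x, ‖gradient (ψ n) x‖ ≤ K := by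
    intro n x
    rw [gradient, LinearIsometryEquiv.norm_map, (hψd n x).fderiv, norm_smul,
      Real.norm_of_nonneg (hc0 n).le]
    calc c n * _ ≤ 1 * K := by gcongr; exacts [hc1 n, hK _]
      _ = K := one_mul K
  have hηg : ∀ n x, gradient (η n) x = ψ n x • gradient W x + W x • gradient (ψ n) x := by
    intro n x
    have h1 := (hψd n x).mul ((hW.differentiable (by simp) x).hasFDerivAt)
    rw [gradient, gradient, gradient, show fderiv ℝ (η n) x = _ from h1.fderiv, (hψd n x).fderiv]
    simp
  have hev : ∀ x, ∀ᶠ n in atTop, ψ n =ᶠ[𝓝 x] fun _ => 1 := by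
    intro x
    have h1 : Tendsto (fun n => c n * (‖x‖ + 1)) atTop (𝓝 0) := by
      simpa using hct.mul_const (‖x‖ + 1)
    filter_upwards [h1.eventually (gt_mem_nhds one_pos)] with n hn
    filter_upwards [ball_mem_nhds x one_pos] with y hy
    refine χ.one_of_mem_closedBall ?_
    rw [mem_closedBall_zero_iff, norm_smul, Real.norm_of_nonneg (hc0 n).le]
    have : ‖y‖ ≤ ‖x‖ + 1 := by
      have := norm_le_norm_add_norm_sub' y x
      rw [mem_ball, dist_eq_norm] at hy
      linarith
    calc c n * ‖y‖ ≤ c n * (‖x‖ + 1) := by gcongr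
      _ ≤ 1 := hn.le
  have hWg := continuous_gradient (hW.of_le (by exact_mod_cast le_top) : ContDiff ℝ 1 W)
  have hηgc : ∀ n, Continuous (gradient (η n)) := fun n =>
    continuous_gradient ((hη n).1.of_le (by exact_mod_cast le_top))
  have hWc := hW.continuous
  have lim1 : Tendsto (fun n => ∫⁻ x, ‖η n x - W x‖ₑ ^ 2) atTop (𝓝 (∫⁻ _ : E3, 0)) := by
    refine tendsto_lintegral_of_dominated_convergence (fun x => ‖W x‖ₑ ^ 2) ?_ ?_ ?_ ?_
    · intro n
      have := (hη n).1.continuous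
      fun_prop
    · intro n
      refine ae_of_all _ fun x => ?_
      have : ‖η n x - W x‖ₑ ≤ ‖W x‖ₑ := by
        rw [enorm_le_iff_norm_le, show η n x - W x = -((1 - ψ n x) * W x) by simp only [η]; ring,
          norm_neg, norm_mul, Real.norm_of_nonneg (by linarith [(hψ01 n x).2])]
        exact mul_le_of_le_one_left (norm_nonneg _) (by linarith [(hψ01 n x).1])
      exact pow_le_pow_left' this 2
    · exact hW2.lintegral_enorm_sq_lt_top.ne
    · refine ae_of_all _ fun x => ?_
      refine tendsto_const_nhds.congr' ?_
      filter_upwards [hev x] with n hn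
      simp [η, hn.eq_of_nhds]
  have lim2 : Tendsto (fun n => ∫⁻ x, ‖gradient (η n) x - gradient W x‖ₑ ^ 2) atTop
      (𝓝 (∫⁻ _ : E3, 0)) := by
    refine tendsto_lintegral_of_dominated_convergence
      (fun x => 2 * ‖gradient W x‖ₑ ^ 2 + 2 * (ENNReal.ofReal K ^ 2 * ‖W x‖ₑ ^ 2)) ?_ ?_ ?_ ?_
    · intro n
      have := hηgc n
      fun_prop
    · intro n
      refine ae_of_all _ fun x => ?_
      have h1 : ‖gradient (η n) x - gradient W x‖ₑ ≤
          ‖gradient W x‖ₑ + ENNReal.ofReal K * ‖W x‖ₑ := by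
        rw [hηg, show ψ n x • gradient W x + W x • gradient (ψ n) x - gradient W x =
          (ψ n x - 1) • gradient W x + W x • gradient (ψ n) x by module]
        refine (enorm_add_le _ _).trans ?_
        rw [enorm_smul, enorm_smul, mul_comm ‖W x‖ₑ]
        gcongr
        · refine mul_le_of_le_one_left' ?_
          rw [← enorm_one (G := ℝ), enorm_le_iff_norm_le, norm_one, Real.norm_eq_abs, abs_le]
          constructor <;> linarith [(hψ01 n x).1, (hψ01 n x).2]
        · rw [← ofReal_norm]
          exact ENNReal.ofReal_le_ofReal (hψg n x)
      have h2 := ENNReal.rpow_add_le_mul_rpow_add_rpow ‖gradient W x‖ₑ (ENNReal.ofReal K * ‖W x‖ₑ)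
        (p := 2) (by norm_num)
      have e : (2 : ℝ≥0∞) ^ ((2 : ℝ) - 1) = 2 := by norm_num
      rw [e, ENNReal.rpow_two, ENNReal.rpow_two, ENNReal.rpow_two, mul_add, mul_pow] at h2
      exact (pow_le_pow_left' h1 2).trans h2
    · rw [lintegral_add_right _ (by fun_prop), lintegral_const_mul _ (by fun_prop),
        lintegral_const_mul _ (by fun_prop), lintegral_const_mul _ (by fun_prop)]
      have a1 := hW2.lintegral_enorm_sq_lt_top.ne
      have a2 := hG2.lintegral_enorm_sq_lt_top.ne
      finiteness
    · refine ae_of_all _ fun x => ?_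
      refine tendsto_const_nhds.congr' ?_
      filter_upwards [hev x] with n hn
      have e1 : fderiv ℝ (ψ n) x = 0 := by
        rw [hn.fderiv_eq]; exact fderiv_const_apply _
      rw [hηg, gradient, gradient, e1, hn.eq_of_nhds]
      simp
  rw [lintegral_zero] at lim1 lim2
  obtain ⟨n, hn1, hn2⟩ := ((lim1.eventually (ge_mem_nhds hε)).and
    (lim2.eventually (ge_mem_nhds hε))).exists
  exact ⟨η n, hη n, hn1, hn2⟩

theorem IsH1WithGradient.exists_testFunction_approx {w : E3 → ℝ} {G : E3 → E3}
    (h : IsH1WithGradient w G) {ε : ℝ≥0∞} (hε : 0 < ε) (hεt : ε ≠ ⊤) :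
    ∃ η : E3 → ℝ, IsTestFunction η ∧ ∫⁻ x, ‖η x - w x‖ₑ ^ 2 ≤ ε ∧
      ∫⁻ x, ‖gradient η x - G x‖ₑ ^ 2 ≤ ε := by
  have hε' : 0 < ε / 4 := ENNReal.div_pos hε.ne' (by norm_num)
  have hεt' : ε / 4 < ⊤ := ENNReal.div_lt_top hεt (by norm_num)
  obtain ⟨W, hW, h1, h2⟩ := exists_smooth_approx h hε'
  have hWg := continuous_gradient (hW.of_le (by exact_mod_cast le_top) : ContDiff ℝ 1 W)
  have m1 : AEStronglyMeasurable (fun x => W x - w x) volume :=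
    hW.continuous.aestronglyMeasurable.sub h.1.1
  have m2 : AEStronglyMeasurable (fun x => gradient W x - G x) volume :=
    hWg.aestronglyMeasurable.sub h.2.1.1
  have hW2 : MemLp W 2 volume := by
    have := (memLp_two_of_lintegral_enorm_sq_lt_top m1 (h1.trans_lt hεt')).add h.1
    simpa [Pi.add_def] using this
  have hG2 : MemLp (gradient W) 2 volume := by
    have := (memLp_two_of_lintegral_enorm_sq_lt_top m2 (h2.trans_lt hεt')).add h.2.1
    simpa [Pi.add_def] using this
  obtain ⟨η, hη, h3, h4⟩ := exists_testFunction_approx_of_smooth hW hW2 hG2 hε'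
  have hsum : 2 * (ε / 4) + 2 * (ε / 4) = ε := by
    rw [← two_mul, ← mul_assoc, show (2 : ℝ≥0∞) * 2 = 4 by norm_num]
    exact ENNReal.mul_div_cancel (by norm_num) (by norm_num)
  refine ⟨η, hη, ?_, ?_⟩
  · refine (lintegral_enorm_sub_sq_le m1).trans (le_of_le_of_eq ?_ hsum)
    gcongr
  · refine (lintegral_enorm_sub_sq_le m2).trans (le_of_le_of_eq ?_ hsum)
    gcongr

theorem IsH1WithGradient.exists_seq_testFunction {w : E3 → ℝ} {G : E3 → E3}
    (h : IsH1WithGradient w G) : ∃ η : ℕ → E3 → ℝ, (∀ n, IsTestFunction (η n)) ∧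
      Tendsto (fun n => ∫⁻ x, ‖η n x - w x‖ₑ ^ 2) atTop (𝓝 0) ∧
      Tendsto (fun n => ∫⁻ x, ‖gradient (η n) x - G x‖ₑ ^ 2) atTop (𝓝 0) := by
  choose η hη h1 h2 using fun n : ℕ => h.exists_testFunction_approx (ε := ((n : ℝ≥0∞) + 1)⁻¹)
    (by simp) (by simp)
  have hlim : Tendsto (fun n : ℕ => ((n : ℝ≥0∞) + 1)⁻¹) atTop (𝓝 0) := by
    have := (tendsto_add_atTop_iff_nat 1).2 ENNReal.tendsto_inv_nat_nhds_zero
    simpa using this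
  exact ⟨η, hη, tendsto_of_tendsto_of_tendsto_of_le_of_le tendsto_const_nhds hlim
    (fun _ => bot_le) h1, tendsto_of_tendsto_of_tendsto_of_le_of_le tendsto_const_nhds hlim
    (fun _ => bot_le) h2⟩

/-! ### Sobolev embedding and bounds for the Coulomb potential -/

theorem IsTestFunction.memLp {η : E3 → ℝ} (hη : IsTestFunction η) : MemLp η 2 volume :=
  hη.1.continuous.memLp_of_hasCompactSupport hη.2

theorem IsTestFunction.contDiff_one {η : E3 → ℝ} (hη : IsTestFunction η) : ContDiff ℝ 1 η :=
  hη.1.of_le (by exact_mod_cast le_top)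

theorem IsTestFunction.memLp_gradient {η : E3 → ℝ} (hη : IsTestFunction η) :
    MemLp (gradient η) 2 volume := by
  refine (continuous_gradient hη.contDiff_one).memLp_of_hasCompactSupport ?_
  exact (hη.2.fderiv ℝ).comp_left (map_zero (InnerProductSpace.toDual ℝ E3).symm)

theorem tendsto_eLpNorm_two {α F : Type*} [MeasurableSpace α] [NormedAddCommGroup F]
    {μ : Measure α} {f : ℕ → α → F} {g : α → F}
    (h : Tendsto (fun n => ∫⁻ x, ‖f n x - g x‖ₑ ^ 2 ∂μ) atTop (𝓝 0)) :
    Tendsto (fun n => eLpNorm (f n - g) 2 μ) atTop (𝓝 0) := by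
  have h2 := ((ENNReal.continuous_rpow_const (y := 1 / 2)).tendsto 0).comp h
  have e : ∀ n, (∫⁻ x, ‖f n x - g x‖ₑ ^ 2 ∂μ) ^ (1 / 2 : ℝ) = eLpNorm (f n - g) 2 μ := by
    intro n
    rw [← eLpNorm_two_sq, ← ENNReal.rpow_two, ← ENNReal.rpow_mul]
    norm_num
    rfl
  simp only [Function.comp_def, e] at h2
  simpa using h2

theorem IsH1WithGradient.exists_seq_tendsto {w : E3 → ℝ} {G : E3 → E3}
    (h : IsH1WithGradient w G) : ∃ η : ℕ → E3 → ℝ, (∀ n, IsTestFunction (η n)) ∧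
      Tendsto (fun n => ∫⁻ x, ‖η n x - w x‖ₑ ^ 2) atTop (𝓝 0) ∧
      Tendsto (fun n => ∫⁻ x, ‖gradient (η n) x - G x‖ₑ ^ 2) atTop (𝓝 0) ∧
      ∀ᵐ x, Tendsto (fun n => η n x) atTop (𝓝 (w x)) := by
  obtain ⟨η, hη, h1, h2⟩ := h.exists_seq_testFunction
  have h3 := tendstoInMeasure_of_tendsto_eLpNorm (p := 2) (by norm_num)
    (fun n => (hη n).memLp.1) h.1.1 (tendsto_eLpNorm_two h1)
  obtain ⟨ns, hns, hae⟩ := h3.exists_seq_tendsto_ae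
  exact ⟨fun n => η (ns n), fun n => hη _, h1.comp hns.tendsto_atTop, h2.comp hns.tendsto_atTop,
      hae⟩

theorem eLpNorm_gradient_le {w : E3 → ℝ} {G : E3 → E3} (h : IsH1WithGradient w G) {η : E3 → ℝ}
    (hη : IsTestFunction η) :
    eLpNorm (gradient η) 2 volume ≤ eLpNorm (gradient η - G) 2 volume + eLpNorm G 2 volume := by
  have := eLpNorm_add_le (μ := volume) (p := 2) (hη.memLp_gradient.1.sub h.2.1.1) h.2.1.1
      (by norm_num)
  simpa using this

theorem eLpNorm_fderiv (η : E3 → ℝ) :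
    eLpNorm (fderiv ℝ η) 2 volume = eLpNorm (gradient η) 2 volume := by
  refine eLpNorm_congr_norm_ae (ae_of_all _ fun x => ?_)
  rw [gradient, LinearIsometryEquiv.norm_map]

/-- The Sobolev embedding `H¹ ⊆ L⁶`, from the inequality for test functions and Fatou's lemma. -/
theorem IsH1WithGradient.memLp_six {w : E3 → ℝ} {G : E3 → E3} (h : IsH1WithGradient w G) :
    MemLp w 6 volume := by
  obtain ⟨η, hη, -, h2, h3⟩ := h.exists_seq_tendsto
  refine ⟨h.1.1, ?_⟩
  obtain ⟨C, hC⟩ : ∃ C : NNReal,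
      ∀ n, eLpNorm (η n) 6 volume ≤ C * eLpNorm (gradient (η n)) 2 volume := by
    refine ⟨SNormLESNormFDerivOfEqConst ℝ (volume : Measure E3) (2 : NNReal), fun n => ?_⟩
    rw [← eLpNorm_fderiv]
    exact eLpNorm_le_eLpNorm_fderiv_of_eq volume (hη n).contDiff_one (hη n).2
      (p := 2) (p' := 6) (by norm_num) (by simp) (by rw [finrank_euclideanSpace]; norm_num)
  have hG := h.2.1.2.ne
  have hlim := (tendsto_eLpNorm_two h2).eventually (ge_mem_nhds (zero_lt_one (α := ℝ≥0∞)))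
  have hb : ∀ᶠ n in atTop, eLpNorm (η n) 6 volume ≤ C * (1 + eLpNorm G 2 volume) := by
    filter_upwards [hlim] with n hn
    refine (hC n).trans ?_
    gcongr
    refine (eLpNorm_gradient_le h (hη n)).trans ?_
    gcongr
  exact (Lp.eLpNorm_le_of_ae_tendsto hb (fun n => (hη n).memLp.1) h3).trans_lt (by finiteness)

theorem IsH1WithGradient.lintegral_four_lt_top {w : E3 → ℝ} {G : E3 → E3}
    (h : IsH1WithGradient w G) : ∫⁻ x, ‖w x‖ₑ ^ 4 < ⊤ := by
  have h6 : ∫⁻ x, ‖w x‖ₑ ^ 6 < ⊤ := by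
    have := eLpNorm_nnreal_pow_eq_lintegral (μ := volume) (f := w) (p := 6) (by norm_num)
    have e : ((6 : NNReal) : ℝ) = (6 : ℕ) := by norm_num
    rw [e] at this
    simp only [ENNReal.rpow_natCast] at this
    rw [← this]
    exact ENNReal.pow_lt_top h.memLp_six.2
  have h2 := h.1.lintegral_enorm_sq_lt_top
  calc ∫⁻ x, ‖w x‖ₑ ^ 4 ≤ ∫⁻ x, (‖w x‖ₑ ^ 2 + ‖w x‖ₑ ^ 6) := by
        refine lintegral_mono fun x => ?_
        rcases le_total ‖w x‖ₑ 1 with h | h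
        · exact (pow_le_pow_right_of_le_one' h (by norm_num)).trans le_self_add
        · exact (pow_le_pow_right' h (by norm_num)).trans le_add_self
    _ = (∫⁻ x, ‖w x‖ₑ ^ 2) + ∫⁻ x, ‖w x‖ₑ ^ 6 :=
        lintegral_add_left' (h.1.1.enorm.pow_const 2) _
    _ < ⊤ := ENNReal.add_lt_top.2 ⟨h2, h6⟩

/-- The energy estimate for test functions extends to `H¹`; only the factor `w` is approximated, the
density `f` stays fixed. -/
theorem IsH1WithGradient.sq_lintegral_enorm_mul_le {w : E3 → ℝ} {G : E3 → E3}
    (h : IsH1WithGradient w G) {f : E3 → ℝ≥0∞} (hf : Measurable f) (hE : coulombEnergy f f ≠ ⊤) :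
    (∫⁻ x, ‖w x‖ₑ * f x) ^ 2 ≤ (∫⁻ x, ‖G x‖ₑ ^ 2) * coulombEnergy f f := by
  obtain ⟨η, hη, -, h2, h3⟩ := h.exists_seq_tendsto
  set s : ℝ≥0∞ := coulombEnergy f f ^ (1 / 2 : ℝ) with hs
  have hs2 : s ^ 2 = coulombEnergy f f := by
    rw [hs, ← ENNReal.rpow_two, ← ENNReal.rpow_mul]; norm_num
  have hst : s ≠ ⊤ := by intro h; rw [h] at hs2; exact hE (by rw [← hs2]; rfl)
  have hb : ∀ n, ∫⁻ x, ‖η n x‖ₑ * f x ≤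
      (eLpNorm (gradient (η n) - G) 2 volume + eLpNorm G 2 volume) * s := by
    intro n
    have h4 := _root_.sq_lintegral_enorm_mul_le (hη n).contDiff_one (hη n).2 hf
    rw [← eLpNorm_two_sq, ← hs2, ← mul_pow, ENNReal.pow_le_pow_left_iff (by norm_num),
        eLpNorm_fderiv] at h4
    refine h4.trans ?_
    gcongr
    exact eLpNorm_gradient_le h (hη n)
  have hlim : Tendsto (fun n => (eLpNorm (gradient (η n) - G) 2 volume + eLpNorm G 2 volume) * s)
      atTop (𝓝 ((0 + eLpNorm G 2 volume) * s)) :=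
    ENNReal.Tendsto.mul_const ((tendsto_eLpNorm_two h2).add_const _) (Or.inr hst)
  have hle : ∫⁻ x, ‖w x‖ₑ * f x ≤ eLpNorm G 2 volume * s := by
    calc ∫⁻ x, ‖w x‖ₑ * f x ≤ ∫⁻ x, liminf (fun n => ‖η n x‖ₑ * f x) atTop := by
          refine lintegral_mono_ae ?_
          filter_upwards [h3] with x hx
          -- multiplication by `⊤` is not continuous at `0`, so this value is treated apart
          by_cases hfx : f x = ⊤
          · by_cases hw : w x = 0
            · simp [hw]
            · have hev : ∀ᶠ n in atTop, ‖η n x‖ₑ * f x = ⊤ := by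
                filter_upwards [hx.eventually_ne hw] with n hn
                rw [hfx]; exact ENNReal.mul_top (by simpa using hn)
              have : Tendsto (fun n => ‖η n x‖ₑ * f x) atTop (𝓝 ⊤) :=
                tendsto_const_nhds.congr' (by filter_upwards [hev] with n hn; exact hn.symm)
              rw [this.liminf_eq]; exact le_top
          · have : Tendsto (fun n => ‖η n x‖ₑ * f x) atTop (𝓝 (‖w x‖ₑ * f x)) :=
              ENNReal.Tendsto.mul_const hx.enorm (Or.inr hfx)
            rw [this.liminf_eq]
      _ ≤ liminf (fun n => ∫⁻ x, ‖η n x‖ₑ * f x) atTop := by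
          refine lintegral_liminf_le fun n => ?_
          have := (hη n).1.continuous
          fun_prop
      _ ≤ liminf (fun n => (eLpNorm (gradient (η n) - G) 2 volume + eLpNorm G 2 volume) * s)
          atTop :=
          liminf_le_liminf (Eventually.of_forall hb)
      _ = _ := by rw [hlim.liminf_eq, zero_add]
  calc _ ≤ (eLpNorm G 2 volume * s) ^ 2 := by gcongr
    _ = _ := by rw [mul_pow, eLpNorm_two_sq, hs2]

/-- The Coulomb potential with values in `[0, ∞]`. -/
noncomputable def lcoulombPotential (w : E3 → ℝ) (x : E3) : ℝ≥0∞ :=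
  ∫⁻ y, ‖w y‖ₑ ^ 2 * invNorm (x - y)

theorem measurable_lcoulombPotential {w : E3 → ℝ} (hw : Measurable w) :
    Measurable (lcoulombPotential w) := by
  unfold lcoulombPotential
  exact Measurable.lintegral_prod_right'
    (f := fun q : E3 × E3 => ‖w q.2‖ₑ ^ 2 * invNorm (q.1 - q.2)) (by fun_prop)

theorem coulombPotential_eq_toReal {w : E3 → ℝ} (hw : Measurable w) (x : E3) :
    coulombPotential w x = (lcoulombPotential w x).toReal := by
  rw [coulombPotential, integral_eq_lintegral_of_nonneg_ae (ae_of_all _ fun y => by positivity)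
    (Measurable.aestronglyMeasurable (by fun_prop)), lcoulombPotential]
  congr 1
  refine lintegral_congr_ae ?_
  have hy : ∀ᵐ y : E3, y ≠ x := by simp [ae_iff, measure_singleton]
  filter_upwards [hy] with y hy
  have hpos : 0 < ‖x - y‖ := norm_pos_iff.2 (sub_ne_zero.2 hy.symm)
  rw [div_eq_mul_inv, ENNReal.ofReal_mul (by positivity), ENNReal.ofReal_inv_of_pos hpos,
    invNorm, ofReal_norm, ← sq_abs, ENNReal.ofReal_pow (abs_nonneg _), ← Real.norm_eq_abs,
        ofReal_norm]

theorem lintegral_invNorm_sq_ball (x : E3) :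
    ∫⁻ y, (if ‖x - y‖ < 1 then invNorm (x - y) ^ 2 else 0) = ENNReal.ofReal (4 * Real.pi) := by
  have hm : Measurable fun r : ℝ => if r < 1 then ‖r‖ₑ⁻¹ ^ 2 else 0 :=
    Measurable.ite measurableSet_Iio (by fun_prop) (by fun_prop)
  rw [lintegral_sub_left_eq_self (fun y => if ‖y‖ < 1 then invNorm y ^ 2 else 0) x]
  have h := lintegral_radial hm
  simp only [enorm_norm] at h
  simp only [invNorm, h]
  have h2 : ∀ r ∈ Ioi (0 : ℝ), ENNReal.ofReal (r ^ 2) * (if r < 1 then ‖r‖ₑ⁻¹ ^ 2 else 0) =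
      (Iio (1 : ℝ)).indicator (fun _ => 1) r := by
    intro r hr
    by_cases h : r < 1
    · rw [if_pos h, indicator_of_mem (mem_Iio.2 h), ENNReal.ofReal_pow (mem_Ioi.1 hr).le,
        ← Real.enorm_of_nonneg (mem_Ioi.1 hr).le, ← mul_pow,
        ENNReal.mul_inv_cancel (by simpa using (mem_Ioi.1 hr).ne') (by simp), one_pow]
    · rw [if_neg h, indicator_of_notMem (by simpa using h), mul_zero]
  rw [setLIntegral_congr_fun measurableSet_Ioi h2, setLIntegral_indicator measurableSet_Iio,
    setLIntegral_const, inter_comm, Ioi_inter_Iio, Real.volume_Ioo]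
  simp

/-- The Coulomb potential of an `H¹` function is bounded: `1 / |x| ≤ 1` outside the unit ball, while
inside it `w²` and `1 / |x|` are both square integrable. -/
theorem IsH1WithGradient.exists_lcoulombPotential_le {w : E3 → ℝ} {G : E3 → E3}
    (h : IsH1WithGradient w G) : ∃ M : NNReal, ∀ x, lcoulombPotential w x ≤ M := by
  have h2 := h.1.lintegral_enorm_sq_lt_top
  have h4 := h.lintegral_four_lt_top
  have hM : (∫⁻ x, ‖w x‖ₑ ^ 2) + ((∫⁻ x, ‖w x‖ₑ ^ 4) + ENNReal.ofReal (4 * Real.pi)) ≠ ⊤ := by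
    finiteness
  refine ⟨((∫⁻ x, ‖w x‖ₑ ^ 2) + ((∫⁻ x, ‖w x‖ₑ ^ 4) + ENNReal.ofReal (4 * Real.pi))).toNNReal,
      fun x => ?_⟩
  rw [ENNReal.coe_toNNReal hM, ← lintegral_invNorm_sq_ball x,
    ← lintegral_add_left' (h.1.1.enorm.pow_const 4),
    ← lintegral_add_left' (h.1.1.enorm.pow_const 2)]
  refine lintegral_mono fun y => ?_
  dsimp only
  split_ifs with hxy
  · refine le_trans ?_ le_add_self
    rcases le_total (‖w y‖ₑ ^ 2) (invNorm (x - y)) with hle | hle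
    · calc _ ≤ invNorm (x - y) * invNorm (x - y) := by gcongr
        _ = invNorm (x - y) ^ 2 := (sq _).symm
        _ ≤ _ := le_add_self
    · calc _ ≤ ‖w y‖ₑ ^ 2 * ‖w y‖ₑ ^ 2 := by gcongr
        _ = ‖w y‖ₑ ^ 4 := by ring
        _ ≤ _ := le_self_add
  · refine le_trans (mul_le_of_le_one_right' ?_) le_self_add
    rw [invNorm, ENNReal.inv_le_one, ← ofReal_norm]
    exact ENNReal.one_le_ofReal.2 (not_lt.1 hxy)

theorem coulombEnergy_eq {w z : E3 → ℝ} (hz : Measurable z) :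
    coulombEnergy (fun x => ‖w x‖ₑ ^ 2) (fun x => ‖z x‖ₑ ^ 2) =
      ∫⁻ x, ‖w x‖ₑ ^ 2 * lcoulombPotential z x := by
  refine lintegral_congr fun x => ?_
  rw [lcoulombPotential, ← lintegral_const_mul _ (by fun_prop)]
  simp only [mul_assoc]

theorem coulombEnergy_comm {f g : E3 → ℝ≥0∞} (hf : Measurable f) (hg : Measurable g) :
    coulombEnergy f g = coulombEnergy g f := by
  rw [coulombEnergy, lintegral_lintegral_swap (Measurable.aemeasurable (by fun_prop))]
  refine lintegral_congr fun x => lintegral_congr fun y => ?_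
  rw [invNorm_sub_comm, mul_comm (f y)]

theorem coulombEnergy_lt_top {w z : E3 → ℝ} (hw : Measurable w) (hz : Measurable z)
    (hw2 : MemLp w 2 volume) {M : NNReal} (hM : ∀ x, lcoulombPotential z x ≤ M) :
    coulombEnergy (fun x => ‖w x‖ₑ ^ 2) (fun x => ‖z x‖ₑ ^ 2) < ⊤ := by
  have h2 := hw2.lintegral_enorm_sq_lt_top
  rw [coulombEnergy_eq hz]
  calc _ ≤ ∫⁻ x, ‖w x‖ₑ ^ 2 * M := by gcongr; exact hM _
    _ = (∫⁻ x, ‖w x‖ₑ ^ 2) * M := lintegral_mul_const _ (by fun_prop)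
    _ < ⊤ := by finiteness

theorem integral_coulombPotential_mul_sq {w z : E3 → ℝ} (hw : Measurable w) (hz : Measurable z)
    {M : NNReal} (hM : ∀ x, lcoulombPotential z x ≤ M) :
    ∫ x, coulombPotential z x * w x ^ 2 =
      (coulombEnergy (fun x => ‖w x‖ₑ ^ 2) (fun x => ‖z x‖ₑ ^ 2)).toReal := by
  have hm := measurable_lcoulombPotential hz
  have e : ∀ x, coulombPotential z x * w x ^ 2 = (‖w x‖ₑ ^ 2 * lcoulombPotential z x).toReal := by
    intro x
    rw [coulombPotential_eq_toReal hz, ENNReal.toReal_mul, ENNReal.toReal_pow, toReal_enorm,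
      Real.norm_eq_abs, sq_abs, mul_comm]
  simp only [e]
  rw [integral_toReal (by fun_prop), coulombEnergy_eq hz]
  refine ae_of_all _ fun x => ENNReal.mul_lt_top (by finiteness) ((hM x).trans_lt (by simp))

/-! ### The nonlinearity -/

theorem norm_averagedPower_le {p : ℝ} (hp : 1 < p) (a b : ℝ) :
    ‖averagedPower p a b‖ ≤ (|a| + |b|) ^ p := by
  have hs : 0 ≤ |a| + |b| := by positivity
  have hz : ∀ θ : ℝ, ‖(a : ℂ) + Complex.exp (θ * Complex.I) * (b : ℂ)‖ ≤ |a| + |b| := by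
    intro θ
    refine (norm_add_le _ _).trans ?_
    rw [norm_mul, Complex.norm_exp_ofReal_mul_I, one_mul, Complex.norm_real, Complex.norm_real,
      Real.norm_eq_abs, Real.norm_eq_abs]
  have h1 := intervalIntegral.norm_integral_le_of_norm_le_const (a := 0) (b := 2 * Real.pi)
    (C := (|a| + |b|) ^ p)
    (f := fun θ : ℝ => ((‖(a : ℂ) + Complex.exp (θ * Complex.I) * (b : ℂ)‖ ^ (p - 1) : ℝ) : ℂ) *
      ((a : ℂ) + Complex.exp (θ * Complex.I) * (b : ℂ))) (fun θ _ => by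
      rw [norm_mul, Complex.norm_real, Real.norm_of_nonneg (by positivity)]
      calc _ ≤ (|a| + |b|) ^ (p - 1) * (|a| + |b|) := by
            exact mul_le_mul (Real.rpow_le_rpow (norm_nonneg _) (hz θ) (by linarith)) (hz θ)
              (norm_nonneg _) (by positivity)
        _ = (|a| + |b|) ^ p := by
            rw [← Real.rpow_add_one' hs (by linarith)]; congr 1; ring)
  rw [averagedPower, norm_mul]
  have hpi := Real.pi_pos
  have e : ‖(1 / (2 * (Real.pi : ℂ)))‖ = (2 * Real.pi)⁻¹ := by
    simp [abs_of_pos hpi]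
  rw [e]
  calc _ ≤ (2 * Real.pi)⁻¹ * ((|a| + |b|) ^ p * |2 * Real.pi - 0|) := by gcongr
    _ = (|a| + |b|) ^ p := by
      rw [sub_zero, abs_of_pos (show 0 < 2 * Real.pi by positivity)]
      field_simp

theorem continuous_averagedPower {p : ℝ} (hp : 1 < p) :
    Continuous fun q : ℝ × ℝ => averagedPower p q.1 q.2 := by
  unfold averagedPower
  refine continuous_const.mul ?_
  refine intervalIntegral.continuous_parametric_intervalIntegral_of_continuous' ?_ _ _
  have h1 : Continuous fun x : (ℝ × ℝ) × ℝ =>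
      (x.1.1 : ℂ) + Complex.exp (x.2 * Complex.I) * (x.1.2 : ℂ) := by fun_prop
  exact (Complex.continuous_ofReal.comp
    (h1.norm.rpow_const fun _ => Or.inr (by linarith))).mul h1

/-- The threshold for `det / trace` of the coupling matrix. -/
noncomputable def couplingThreshold (p l : ℝ) : ℝ :=
  if p < 2 then (p - 1) ^ 2 / 4 * ((2 : ℝ) ^ p * (2 - p) ^ (2 - p) / l ^ (2 - p)) ^ (2 / (p - 1))
  else 4

theorem couplingThreshold_nonneg {p l : ℝ} (hl : 0 < l) : 0 ≤ couplingThreshold p l := by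
  unfold couplingThreshold
  split_ifs with h
  · have : 0 < 2 - p := by linarith
    positivity
  · norm_num

/-- The threshold is the least value for which this holds: the weighted inequality between
arithmetic and geometric means with weights `2 - p` and `p - 1`. -/
theorem two_rpow_mul_rpow_le {p l : ℝ} (hp₁ : 1 < p) (hp₂ : p ≤ 2) (hl : 0 < l) {t : ℝ}
    (ht : 0 ≤ t) :
    (2 : ℝ) ^ p * t ^ (p - 1) ≤ l + 2 * √(couplingThreshold p l) * t := by
  unfold couplingThreshold
  split_ifs with h
  · have h2 : 0 < 2 - p := by linarith
    have h1 : 0 < p - 1 := by linarith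
    set B : ℝ := (2 : ℝ) ^ p * (2 - p) ^ (2 - p) / l ^ (2 - p) with hB
    have hB0 : 0 < B := by positivity
    have hs : √((p - 1) ^ 2 / 4 * B ^ (2 / (p - 1))) = (p - 1) / 2 * B ^ (1 / (p - 1)) := by
      rw [show (p - 1) ^ 2 / 4 * B ^ (2 / (p - 1)) = ((p - 1) / 2 * B ^ (1 / (p - 1))) ^ 2 by
        rw [mul_pow, ← Real.rpow_mul_natCast hB0.le]; push_cast; ring_nf]
      exact Real.sqrt_sq (by positivity)
    have ham := Real.geom_mean_le_arith_mean2_weighted h2.le h1.le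
      (show 0 ≤ l / (2 - p) by positivity) (show 0 ≤ B ^ (1 / (p - 1)) * t by positivity) (by ring)
    rw [Real.mul_rpow (by positivity) ht, ← Real.rpow_mul hB0.le, one_div_mul_cancel h1.ne',
      Real.rpow_one, Real.div_rpow hl.le h2.le, hB] at ham
    rw [hs]
    have hl' : 0 < l ^ (2 - p) := by positivity
    have hp' : 0 < (2 - p) ^ (2 - p) := by positivity
    calc (2 : ℝ) ^ p * t ^ (p - 1) = l ^ (2 - p) / (2 - p) ^ (2 - p) *
          (2 ^ p * (2 - p) ^ (2 - p) / l ^ (2 - p) * t ^ (p - 1)) := by field_simp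
      _ ≤ _ := ham
      _ = _ := by rw [← hB]; field_simp
  · have hp : p = 2 := le_antisymm hp₂ (not_lt.1 h)
    subst hp
    rw [show (4 : ℝ) = 2 ^ 2 by norm_num, Real.sqrt_sq (by norm_num)]
    norm_num
    linarith

theorem add_rpow_le {p l : ℝ} (hp₁ : 1 < p) (hp₂ : p ≤ 2) (hl : 0 < l) (a b : ℝ) :
    (|a| + |b|) ^ (p + 1) ≤
      l * (a ^ 2 + b ^ 2) + 2 * √(couplingThreshold p l) * (|a| ^ 3 + |b| ^ 3) := by
  have key : ∀ t : ℝ, 0 ≤ t → (2 : ℝ) ^ p * t ^ (p + 1) ≤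
      l * t ^ 2 + 2 * √(couplingThreshold p l) * t ^ 3 := by
    intro t ht
    have h := mul_le_mul_of_nonneg_right (two_rpow_mul_rpow_le hp₁ hp₂ hl ht) (sq_nonneg t)
    have e : t ^ (p + 1) = t ^ (p - 1) * t ^ 2 := by
      rw [← Real.rpow_add_natCast' ht (by push_cast; linarith)]; push_cast; congr 1; ring
    rw [e]
    linarith [h]
  have h1 : (|a| + |b|) ^ (p + 1) ≤ 2 ^ p * (|a| ^ (p + 1) + |b| ^ (p + 1)) := by
    have := NNReal.rpow_add_le_mul_rpow_add_rpow ‖a‖₊ ‖b‖₊ (p := p + 1) (by linarith)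
    rw [add_sub_cancel_right] at this
    simpa using NNReal.coe_le_coe.2 this
  have ha := key |a| (abs_nonneg a)
  have hb := key |b| (abs_nonneg b)
  rw [sq_abs] at ha hb
  linarith

/-- Since `p ≤ 2`, the nonlinearity grows at most quadratically, and `L² ∩ L⁴` suffices. -/
theorem memLp_averagedPower {p : ℝ} (hp₁ : 1 < p) (hp₂ : p ≤ 2) {u v : E3 → ℝ} {Gu Gv : E3 → E3}
    (hu : IsH1WithGradient u Gu) (hv : IsH1WithGradient v Gv) :
    MemLp (fun x => averagedPower p (u x) (v x)) 2 volume := by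
  have hm : AEStronglyMeasurable (fun x => averagedPower p (u x) (v x)) volume :=
    (continuous_averagedPower hp₁).comp_aestronglyMeasurable (f := fun x => (u x, v x))
      (hu.1.1.prodMk hv.1.1)
  refine memLp_two_of_lintegral_enorm_sq_lt_top hm ?_
  have hpt : ∀ a b : ℝ, ‖averagedPower p a b‖ₑ ^ 2 ≤
      2 * (‖a‖ₑ ^ 2 + ‖b‖ₑ ^ 2) + 8 * (‖a‖ₑ ^ 4 + ‖b‖ₑ ^ 4) := by
    intro a b
    have h0 : ‖averagedPower p a b‖ ^ 2 ≤ 2 * (|a| ^ 2 + |b| ^ 2) + 8 * (|a| ^ 4 + |b| ^ 4) := by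
      have hs : 0 ≤ |a| + |b| := by positivity
      have h1 : (|a| + |b|) ^ p ≤ max (|a| + |b|) ((|a| + |b|) ^ 2) := by
        rcases le_total (|a| + |b|) 1 with h | h
        · refine le_max_of_le_left ?_
          rcases hs.eq_or_lt with h0 | h0
          · rw [← h0, Real.zero_rpow (by linarith)]
          · simpa using Real.rpow_le_rpow_of_exponent_ge h0 h hp₁.le
        · refine le_max_of_le_right ?_
          rw [← Real.rpow_two]
          exact Real.rpow_le_rpow_of_exponent_le h hp₂
      have h2 : ‖averagedPower p a b‖ ^ 2 ≤ (|a| + |b|) ^ 2 + (|a| + |b|) ^ 4 := by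
        have h3 := (norm_averagedPower_le hp₁ a b).trans h1
        rcases le_max_iff.1 h3 with h | h
        · calc _ ≤ (|a| + |b|) ^ 2 := by gcongr
            _ ≤ _ := le_add_of_nonneg_right (by positivity)
        · calc _ ≤ ((|a| + |b|) ^ 2) ^ 2 := by gcongr
            _ = (|a| + |b|) ^ 4 := by ring
            _ ≤ _ := le_add_of_nonneg_left (by positivity)
      have h4 : (|a| + |b|) ^ 2 ≤ 2 * (|a| ^ 2 + |b| ^ 2) := add_sq_le
      have h5 : (|a| + |b|) ^ 4 ≤ 8 * (|a| ^ 4 + |b| ^ 4) := by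
        have := add_pow_le (abs_nonneg a) (abs_nonneg b) 4
        norm_num at this ⊢
        linarith
      linarith
    have h1 := ENNReal.ofReal_le_ofReal h0
    rw [ENNReal.ofReal_pow (norm_nonneg _), ofReal_norm] at h1
    refine h1.trans_eq ?_
    rw [ENNReal.ofReal_add (by positivity) (by positivity), ENNReal.ofReal_mul (by norm_num),
      ENNReal.ofReal_mul (by norm_num), ENNReal.ofReal_add (by positivity) (by positivity),
      ENNReal.ofReal_add (by positivity) (by positivity)]
    simp only [← Real.norm_eq_abs]
    simp only [ENNReal.ofReal_pow (norm_nonneg _), ofReal_norm, ENNReal.ofReal_ofNat]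
  refine (lintegral_mono fun x => hpt (u x) (v x)).trans_lt ?_
  have hum := hu.1.1.enorm
  have hvm := hv.1.1.enorm
  rw [lintegral_add_left' (by fun_prop), lintegral_const_mul'' _ (by fun_prop),
    lintegral_const_mul'' _ (by fun_prop), lintegral_add_left' (by fun_prop),
    lintegral_add_left' (by fun_prop)]
  have a1 := hu.1.lintegral_enorm_sq_lt_top.ne
  have a2 := hv.1.lintegral_enorm_sq_lt_top.ne
  have a3 := hu.lintegral_four_lt_top.ne
  have a4 := hv.lintegral_four_lt_top.ne
  finiteness

/-! ### Testing the equation against the solution -/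

theorem integrable_inner_of_memLp {F : Type*} [NormedAddCommGroup F] [InnerProductSpace ℝ F]
    {A g : E3 → F} (hA : MemLp A 2 volume) (hg : MemLp g 2 volume) :
    Integrable (fun x => inner ℝ (A x) (g x)) volume := by
  refine Integrable.mono' (hA.norm.integrable_mul hg.norm) (hA.1.inner hg.1)
      (ae_of_all _ fun x => ?_)
  exact norm_inner_le_norm _ _

theorem tendsto_integral_inner {F : Type*} [NormedAddCommGroup F] [InnerProductSpace ℝ F]
    {A g : E3 → F} {f : ℕ → E3 → F} (hA : MemLp A 2 volume) (hg : MemLp g 2 volume)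
    (hf : ∀ n, MemLp (f n) 2 volume)
    (h : Tendsto (fun n => ∫⁻ x, ‖f n x - g x‖ₑ ^ 2) atTop (𝓝 0)) :
    Tendsto (fun n => ∫ x, inner ℝ (A x) (f n x)) atTop (𝓝 (∫ x, inner ℝ (A x) (g x))) := by
  refine tendsto_integral_of_L1 _ (hA.1.inner hg.1)
    (Eventually.of_forall fun n => integrable_inner_of_memLp hA (hf n)) ?_
  have hb : ∀ n, ∫⁻ x, ‖inner ℝ (A x) (f n x) - inner ℝ (A x) (g x)‖ₑ ≤
      ((∫⁻ x, ‖A x‖ₑ ^ 2) * ∫⁻ x, ‖f n x - g x‖ₑ ^ 2) ^ (1 / 2 : ℝ) := by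
    intro n
    have h1 := sq_lintegral_mul_le hA.1.enorm ((hf n).1.sub hg.1).enorm
    have h2 : ∫⁻ x, ‖inner ℝ (A x) (f n x) - inner ℝ (A x) (g x)‖ₑ ≤
        ∫⁻ x, ‖A x‖ₑ * ‖(f n - g) x‖ₑ := by
      refine lintegral_mono fun x => ?_
      rw [← inner_sub_right]
      rw [← ofReal_norm, ← ofReal_norm, ← ofReal_norm, ← ENNReal.ofReal_mul (norm_nonneg _)]
      exact ENNReal.ofReal_le_ofReal (norm_inner_le_norm _ _)
    rw [← ENNReal.rpow_two] at h1
    calc _ ≤ _ := h2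
      _ = ((∫⁻ x, ‖A x‖ₑ * ‖(f n - g) x‖ₑ) ^ (2 : ℝ)) ^ (1 / 2 : ℝ) := by
        rw [← ENNReal.rpow_mul]; norm_num
      _ ≤ _ := ENNReal.rpow_le_rpow h1 (by norm_num)
  refine tendsto_of_tendsto_of_tendsto_of_le_of_le tendsto_const_nhds ?_ (fun _ => bot_le) hb
  have h3 := ENNReal.Tendsto.const_mul h (Or.inr hA.lintegral_enorm_sq_lt_top.ne)
  rw [mul_zero] at h3
  have h4 := ((ENNReal.continuous_rpow_const (y := 1 / 2)).tendsto 0).comp h3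
  rw [ENNReal.zero_rpow_of_pos (by norm_num)] at h4
  exact h4

/-- An equation that holds in the weak sense with square integrable data may be tested against every
function in `H¹`. -/
theorem IsH1WithGradient.integral_inner_add_eq_zero {w B : E3 → ℝ} {G A : E3 → E3}
    (h : IsH1WithGradient w G) (hA : MemLp A 2 volume) (hB : MemLp B 2 volume)
    (htest : ∀ η, IsTestFunction η →
      (∫ x, inner ℝ (A x) (gradient η x)) + ∫ x, inner ℝ (B x) (η x) = 0) :
    (∫ x, inner ℝ (A x) (G x)) + ∫ x, inner ℝ (B x) (w x) = 0 := by
  obtain ⟨η, hη, h1, h2⟩ := h.exists_seq_testFunction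
  have l1 := tendsto_integral_inner hA h.2.1 (fun n => (hη n).memLp_gradient) h2
  have l2 := tendsto_integral_inner hB h.1 (fun n => (hη n).memLp) h1
  have l3 := l1.add l2
  simp only [fun n => htest _ (hη n)] at l3
  exact tendsto_nhds_unique l3 tendsto_const_nhds

theorem memLp_coulombPotential_mul {w u : E3 → ℝ} (hw : Measurable w) (hu : MemLp u 2 volume)
    {M : NNReal} (hM : ∀ x, lcoulombPotential w x ≤ M) :
    MemLp (fun x => coulombPotential w x * u x) 2 volume := by
  have hm : Measurable (coulombPotential w) := by
    rw [show coulombPotential w = fun x => (lcoulombPotential w x).toReal from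
      funext (coulombPotential_eq_toReal hw)]
    exact (measurable_lcoulombPotential hw).ennreal_toReal
  refine MemLp.of_le_mul (c := M) hu (hm.aestronglyMeasurable.mul hu.1) (ae_of_all _ fun x => ?_)
  rw [norm_mul]
  gcongr
  rw [coulombPotential_eq_toReal hw, Real.norm_of_nonneg ENNReal.toReal_nonneg]
  exact ENNReal.toReal_le_coe_of_le_coe (hM x)

/-- The real-valued Coulomb energy of the densities `w²` and `z²`. -/
noncomputable def coulombEnergyReal (w z : E3 → ℝ) : ℝ :=
  (coulombEnergy (fun x => ‖w x‖ₑ ^ 2) (fun x => ‖z x‖ₑ ^ 2)).toReal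

/-- The weak equation tested against the solution itself. -/
theorem IsWeakEquation.integral_eq {p l m k : ℝ} (hp₁ : 1 < p) (hp₂ : p ≤ 2) {u v : E3 → ℝ}
    {Gu Gv : E3 → E3} (hum : Measurable u) (hvm : Measurable v)
    (hu : IsH1WithGradient u Gu) (hv : IsH1WithGradient v Gv)
    (heq : IsWeakEquation p l m k u v Gu) :
    (∫ x, ‖Gu x‖ ^ 2) + l * (∫ x, u x ^ 2) + m * coulombEnergyReal u u - k * coulombEnergyReal u v =
      ∫ x, (averagedPower p (u x) (v x)).re * u x := by
  obtain ⟨M, hM⟩ := hu.exists_lcoulombPotential_le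
  obtain ⟨M', hM'⟩ := hv.exists_lcoulombPotential_le
  have b1 := memLp_coulombPotential_mul hum hu.1 hM
  have b2 := memLp_coulombPotential_mul hvm hu.1 hM'
  have bN := memLp_averagedPower hp₁ hp₂ hu hv
  have bNr : MemLp (fun x => (averagedPower p (u x) (v x)).re) 2 volume := bN.re
  have bL : MemLp (fun x => l * u x + m * (coulombPotential u x * u x) -
      k * (coulombPotential v x * u x)) 2 volume :=
    ((hu.1.const_mul l).add (b1.const_mul m)).sub (b2.const_mul k)
  have bB := bL.sub bNr
  have key := hu.integral_inner_add_eq_zero hu.2.1 bB (fun η hη => by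
    have e := congrArg Complex.re (heq η hη)
    rw [Complex.ofReal_re] at e
    have hi : Integrable (fun x => averagedPower p (u x) (v x) * (η x : ℂ)) volume :=
      bN.integrable_mul hη.memLp.ofReal
    have e2 : (∫ x, averagedPower p (u x) (v x) * (η x : ℂ)).re =
        ∫ x, (averagedPower p (u x) (v x)).re * η x := by
      rw [← RCLike.re_eq_complex_re, ← integral_re hi]
      refine integral_congr_ae (ae_of_all _ fun x => ?_)
      simp
    rw [e2] at e
    have i1 := integrable_inner_of_memLp hu.2.1 hη.memLp_gradient
    have i2 := integrable_inner_of_memLp bL hη.memLp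
    have i3 := integrable_inner_of_memLp bNr hη.memLp
    have e3 : ∫ x, inner ℝ (((fun x => l * u x + m * (coulombPotential u x * u x) -
        k * (coulombPotential v x * u x)) - fun x => (averagedPower p (u x) (v x)).re) x) (η x) =
        (∫ x, inner ℝ (l * u x + m * (coulombPotential u x * u x) -
        k * (coulombPotential v x * u x)) (η x)) -
        ∫ x, inner ℝ (averagedPower p (u x) (v x)).re (η x) := by
      rw [← integral_sub i2 i3]
      simp only [Pi.sub_apply, inner_sub_left]
    rw [e3, ← add_sub_assoc, ← integral_add i1 i2, sub_eq_zero]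
    simp only [RCLike.inner_apply, conj_trivial]
    simp only [mul_comm (η _)]
    rw [← e]
    refine integral_congr_ae (ae_of_all _ fun x => ?_)
    ring)
  have i2 := (integrable_inner_of_memLp hu.1 hu.1).const_mul l
  have i3 := (integrable_inner_of_memLp b1 hu.1).const_mul m
  have i4 := (integrable_inner_of_memLp b2 hu.1).const_mul k
  have i5 := integrable_inner_of_memLp bNr hu.1
  have e1 : ∫ x, inner ℝ (u x) (u x) = ∫ x, u x ^ 2 := by simp [sq]
  have e2 : ∫ x, inner ℝ (coulombPotential u x * u x) (u x) = coulombEnergyReal u u := by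
    rw [coulombEnergyReal, ← integral_coulombPotential_mul_sq hum hum hM]
    simp only [RCLike.inner_apply, conj_trivial]
    congr 1; ext; ring
  have e3 : ∫ x, inner ℝ (coulombPotential v x * u x) (u x) = coulombEnergyReal u v := by
    rw [coulombEnergyReal, ← integral_coulombPotential_mul_sq hum hvm hM']
    simp only [RCLike.inner_apply, conj_trivial]
    congr 1; ext; ring
  have e5 : ∫ x, inner ℝ (averagedPower p (u x) (v x)).re (u x) =
      ∫ x, (averagedPower p (u x) (v x)).re * u x := by
    simp [mul_comm]
  have e4 : ∫ x, inner ℝ (((fun x => l * u x + m * (coulombPotential u x * u x) -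
        k * (coulombPotential v x * u x)) - fun x => (averagedPower p (u x) (v x)).re) x) (u x) =
      l * (∫ x, u x ^ 2) + m * coulombEnergyReal u u - k * coulombEnergyReal u v -
        ∫ x, (averagedPower p (u x) (v x)).re * u x := by
    have i23 : Integrable (fun x => l * inner ℝ (u x) (u x) +
        m * inner ℝ (coulombPotential u x * u x) (u x)) volume := i2.add i3
    have i234 : Integrable (fun x => l * inner ℝ (u x) (u x) +
        m * inner ℝ (coulombPotential u x * u x) (u x) -
        k * inner ℝ (coulombPotential v x * u x) (u x)) volume := i23.sub i4
    rw [← e1, ← e2, ← e3, ← e5, ← integral_const_mul, ← integral_const_mul, ← integral_const_mul,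
      ← integral_add i2 i3, ← integral_sub i23 i4, ← integral_sub i234 i5]
    refine integral_congr_ae (ae_of_all _ fun x => ?_)
    simp only [Pi.sub_apply, RCLike.inner_apply, conj_trivial]
    ring
  rw [e4] at key
  simp only [real_inner_self_eq_norm_sq] at key
  linarith

/-! ### Nonexistence of nontrivial solutions -/

theorem IsWeakEquation.congr {p l m k : ℝ} {u v u' v' : E3 → ℝ} {G G' : E3 → E3}
    (h : IsWeakEquation p l m k u v G) (hu : u =ᵐ[volume] u') (hv : v =ᵐ[volume] v')
    (hG : G =ᵐ[volume] G') : IsWeakEquation p l m k u' v' G' := by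
  intro η hη
  have e : ∀ w w' : E3 → ℝ, w =ᵐ[volume] w' → coulombPotential w' = coulombPotential w := by
    intro w w' hw
    ext x
    exact integral_congr_ae (by filter_upwards [hw] with y hy; rw [hy])
  rw [e u u' hu, e v v' hv]
  have e1 : ∫ x, (inner ℝ (G' x) (gradient η x) + l * u' x * η x +
        (m * coulombPotential u x - k * coulombPotential v x) * u' x * η x) =
      ∫ x, (inner ℝ (G x) (gradient η x) + l * u x * η x +
        (m * coulombPotential u x - k * coulombPotential v x) * u x * η x) :=
    integral_congr_ae (by filter_upwards [hu, hG] with x h1 h2; rw [h1, h2])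
  have e2 : ∫ x, averagedPower p (u' x) (v' x) * (η x : ℂ) =
      ∫ x, averagedPower p (u x) (v x) * (η x : ℂ) :=
    integral_congr_ae (by filter_upwards [hu, hv] with x h1 h2; rw [h1, h2])
  rw [e1, e2]
  exact h η hη

theorem IsSolution.congr {p l m₁₁ m₁₂ m₂₂ : ℝ} {u v u' v' : E3 → ℝ}
    (h : IsSolution p l m₁₁ m₁₂ m₂₂ u v) (hu : u =ᵐ[volume] u') (hv : v =ᵐ[volume] v') :
    IsSolution p l m₁₁ m₁₂ m₂₂ u' v' := by
  obtain ⟨Gu, Gv, h1, h2, h3, h4⟩ := h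
  exact ⟨Gu, Gv, h1.congr hu ae_eq_rfl, h2.congr hv ae_eq_rfl, h3.congr hu hv ae_eq_rfl,
    h4.congr hv hu ae_eq_rfl⟩

theorem isSolution_zero (p l m₁₁ m₁₂ m₂₂ : ℝ) : IsSolution p l m₁₁ m₁₂ m₂₂ 0 0 := by
  have hH : IsH1WithGradient 0 0 := ⟨MemLp.zero, MemLp.zero, fun η _ i => by simp⟩
  have hE : ∀ m k : ℝ, IsWeakEquation p l m k 0 0 0 := fun m k η _ => by simp [averagedPower]
  exact ⟨0, 0, hH, hH, hE _ _, hE _ _⟩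

theorem IsH1WithGradient.integrable_abs_cube {w : E3 → ℝ} {G : E3 → E3}
    (h : IsH1WithGradient w G) : Integrable (fun x => |w x| ^ 3) volume := by
  have h4 : Integrable (fun x => w x ^ 4) volume := by
    refine ⟨h.1.1.pow 4, ?_⟩
    simpa [HasFiniteIntegral, enorm_pow] using h.lintegral_four_lt_top
  refine Integrable.mono' (h.1.integrable_sq.add h4) (h.1.1.norm.pow 3) (ae_of_all _ fun x => ?_)
  rw [norm_pow, Real.norm_eq_abs, abs_abs, Pi.add_apply, ← sq_abs (w x),
    ← (show Even 4 by decide).pow_abs (w x)]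
  nlinarith [sq_nonneg (|w x| - 1), sq_nonneg (|w x|), abs_nonneg (w x),
    mul_nonneg (sq_nonneg (|w x|)) (sq_nonneg (|w x| - 1))]

/-- The cubic norm is controlled by the Dirichlet integral and the Coulomb energy. -/
theorem IsH1WithGradient.sq_integral_abs_cube_le {w : E3 → ℝ} {G : E3 → E3}
    (h : IsH1WithGradient w G) (hw : Measurable w) :
    (∫ x, |w x| ^ 3) ^ 2 ≤ (∫ x, ‖G x‖ ^ 2) * coulombEnergyReal w w := by
  obtain ⟨M, hM⟩ := h.exists_lcoulombPotential_le
  have hE := (coulombEnergy_lt_top hw hw h.1 hM).ne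
  have h1 := h.sq_lintegral_enorm_mul_le (f := fun x => ‖w x‖ₑ ^ 2) (by fun_prop) hE
  have h2 := ENNReal.toReal_mono
    (ENNReal.mul_ne_top h.2.1.lintegral_enorm_sq_lt_top.ne hE) h1
  rw [ENNReal.toReal_pow, ENNReal.toReal_mul] at h2
  have e1 : ∫ x, |w x| ^ 3 = (∫⁻ x, ‖w x‖ₑ * ‖w x‖ₑ ^ 2).toReal := by
    rw [← integral_toReal (by fun_prop) (ae_of_all _ fun x => by finiteness)]
    congr 1; ext x
    rw [ENNReal.toReal_mul, ENNReal.toReal_pow, toReal_enorm, Real.norm_eq_abs]; ring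
  have e2 : ∫ x, ‖G x‖ ^ 2 = (∫⁻ x, ‖G x‖ₑ ^ 2).toReal := by
    have := h.2.1.1.enorm
    rw [← integral_toReal (by fun_prop) (ae_of_all _ fun x => by finiteness)]
    simp only [ENNReal.toReal_pow, toReal_enorm]
  rw [e1, e2]
  exact h2

theorem coulombEnergyReal_nonneg (w z : E3 → ℝ) : 0 ≤ coulombEnergyReal w z := ENNReal.toReal_nonneg

theorem sq_coulombEnergyReal_le {u v : E3 → ℝ} {Gu Gv : E3 → E3} (hum : Measurable u)
    (hvm : Measurable v) (hu : IsH1WithGradient u Gu) (hv : IsH1WithGradient v Gv) :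
    coulombEnergyReal u v ^ 2 ≤ coulombEnergyReal u u * coulombEnergyReal v v := by
  obtain ⟨M, hM⟩ := hu.exists_lcoulombPotential_le
  obtain ⟨M', hM'⟩ := hv.exists_lcoulombPotential_le
  have h := coulombEnergy_sq_le (f := fun x => ‖u x‖ₑ ^ 2) (g := fun x => ‖v x‖ₑ ^ 2)
    (by fun_prop) (by fun_prop)
  have h2 := ENNReal.toReal_mono (ENNReal.mul_ne_top (coulombEnergy_lt_top hum hum hu.1 hM).ne
    (coulombEnergy_lt_top hvm hvm hv.1 hM').ne) h
  rwa [ENNReal.toReal_pow, ENNReal.toReal_mul] at h2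

theorem coulombEnergyReal_comm {u v : E3 → ℝ} (hu : Measurable u) (hv : Measurable v) :
    coulombEnergyReal u v = coulombEnergyReal v u := by
  rw [coulombEnergyReal, coulombEnergy_comm (by fun_prop) (by fun_prop), coulombEnergyReal]

/-- A coercivity bound for a binary quadratic form: `det / trace` bounds the lesser eigenvalue
from below. The numbers `x`, `z` stand for squared norms and `y` for an inner product. -/
theorem det_div_trace_mul_le {a b c x y z : ℝ} (ha : 0 < a) (hb : 0 < b)
    (hx : 0 ≤ x) (hz : 0 ≤ z) (hy : y ^ 2 ≤ x * z) :
    (a * b - c ^ 2) / (a + b) * (x + z) ≤ a * x - 2 * c * y + b * z := by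
  have hab : 0 < a + b := by positivity
  set κ := (a * b - c ^ 2) / (a + b) with hκ
  have hκ' : κ * (a + b) = a * b - c ^ 2 := div_mul_cancel₀ _ hab.ne'
  have h1 : 0 < a - κ := by
    rw [sub_pos, hκ, div_lt_iff₀ hab]; nlinarith [sq_nonneg c, sq_pos_of_pos ha]
  have h2 : 0 < b - κ := by
    rw [sub_pos, hκ, div_lt_iff₀ hab]; nlinarith [sq_nonneg c, sq_pos_of_pos hb]
  -- the difference of the two sides is `κ²`
  have h3 : c ^ 2 ≤ (a - κ) * (b - κ) := by nlinarith [sq_nonneg κ]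
  have h4 : (c * y) ^ 2 ≤ (((a - κ) * x + (b - κ) * z) / 2) ^ 2 := by
    have : (c * y) ^ 2 ≤ ((a - κ) * (b - κ)) * (x * z) := by
      rw [mul_pow]; exact mul_le_mul h3 hy (sq_nonneg _) (by positivity)
    nlinarith [sq_nonneg ((a - κ) * x - (b - κ) * z)]
  have h5 := abs_le_of_sq_le_sq h4 (by positivity)
  linarith [(le_abs_self _).trans h5]

theorem two_sqrt_mul_le {κ X D T : ℝ} (hκ : 0 ≤ κ) (hX : 0 ≤ X) (hD : 0 ≤ D)
    (h : T ^ 2 ≤ X * D) : 2 * √κ * T ≤ X + κ * D := by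
  have h1 : (2 * √κ * T) ^ 2 ≤ (X + κ * D) ^ 2 := by
    have h2 := mul_le_mul_of_nonneg_left h hκ
    rw [mul_pow, mul_pow, Real.sq_sqrt hκ]
    nlinarith [sq_nonneg (X - κ * D)]
  exact (le_abs_self _).trans (abs_le_of_sq_le_sq h1 (by positivity))

/-- The nonexistence part: the sum of the two tested equations bounds
`2 (√κ - √κ₀) (‖u‖₃³ + ‖v‖₃³)` by zero. -/
theorem IsSolution.ae_eq_zero_of_measurable {p l m₁₁ m₁₂ m₂₂ : ℝ} (hp₁ : 1 < p) (hp₂ : p ≤ 2)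
    (hl : 0 < l) (hm₁₁ : 0 < m₁₁) (hm₂₂ : 0 < m₂₂)
    (hdet : couplingThreshold p l < (m₁₁ * m₂₂ - m₁₂ ^ 2) / (m₁₁ + m₂₂))
    {u v : E3 → ℝ} (hum : Measurable u) (hvm : Measurable v)
    (h : IsSolution p l m₁₁ m₁₂ m₂₂ u v) : u =ᵐ[volume] 0 ∧ v =ᵐ[volume] 0 := by
  obtain ⟨Gu, Gv, hu, hv, hequ, heqv⟩ := h
  have hκ₀ := couplingThreshold_nonneg (p := p) hl
  set κ₀ := couplingThreshold p l with hκ₀_def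
  set κ := (m₁₁ * m₂₂ - m₁₂ ^ 2) / (m₁₁ + m₂₂) with hκ_def
  have iu := hequ.integral_eq hp₁ hp₂ hum hvm hu hv
  have iv := heqv.integral_eq hp₁ hp₂ hvm hum hv hu
  rw [coulombEnergyReal_comm hvm hum] at iv
  have cu := hu.integrable_abs_cube
  have cv := hv.integrable_abs_cube
  have su := hu.1.integrable_sq
  have sv := hv.1.integrable_sq
  have nu : Integrable (fun x => (averagedPower p (u x) (v x)).re * u x) volume :=
    (memLp_averagedPower hp₁ hp₂ hu hv).re.integrable_mul hu.1
  have nv : Integrable (fun x => (averagedPower p (v x) (u x)).re * v x) volume :=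
    (memLp_averagedPower hp₁ hp₂ hv hu).re.integrable_mul hv.1
  have hN : (∫ x, (averagedPower p (u x) (v x)).re * u x) +
      (∫ x, (averagedPower p (v x) (u x)).re * v x) ≤
      l * ((∫ x, u x ^ 2) + ∫ x, v x ^ 2) +
        2 * √κ₀ * ((∫ x, |u x| ^ 3) + ∫ x, |v x| ^ 3) := by
    have is : Integrable (fun x => l * (u x ^ 2 + v x ^ 2)) volume := (su.add sv).const_mul l
    have ic : Integrable (fun x => 2 * √κ₀ * (|u x| ^ 3 + |v x| ^ 3)) volume :=
      (cu.add cv).const_mul _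
    rw [← integral_add nu nv, ← integral_add su sv, ← integral_add cu cv, ← integral_const_mul,
      ← integral_const_mul, ← integral_add is ic]
    refine integral_mono (nu.add nv) (is.add ic) fun x => ?_
    refine le_trans ?_ (add_rpow_le hp₁ hp₂ hl (u x) (v x))
    have hb : ∀ a b : ℝ, (averagedPower p a b).re * a ≤ (|a| + |b|) ^ p * |a| := fun a b =>
      calc _ ≤ |(averagedPower p a b).re * a| := le_abs_self _
        _ ≤ _ := by
          rw [abs_mul]
          gcongr
          exact (Complex.abs_re_le_norm _).trans (norm_averagedPower_le hp₁ a b)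
    have h1 := hb (u x) (v x)
    have h2 := hb (v x) (u x)
    rw [add_comm |v x|] at h2
    rw [Real.rpow_add_one' (by positivity) (by linarith), mul_add]
    exact add_le_add h1 h2
  have hQ := det_div_trace_mul_le (c := m₁₂) hm₁₁ hm₂₂ (coulombEnergyReal_nonneg u u)
    (coulombEnergyReal_nonneg v v) (sq_coulombEnergyReal_le hum hvm hu hv)
  have hκ : 0 ≤ κ := hκ₀.trans hdet.le
  have hTu := two_sqrt_mul_le hκ (integral_nonneg fun x => by positivity)
    (coulombEnergyReal_nonneg u u) (hu.sq_integral_abs_cube_le hum)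
  have hTv := two_sqrt_mul_le hκ (integral_nonneg fun x => by positivity)
    (coulombEnergyReal_nonneg v v) (hv.sq_integral_abs_cube_le hvm)
  have hsqrt : √κ₀ < √κ := Real.sqrt_lt_sqrt hκ₀ hdet
  have pu : 0 ≤ ∫ x, |u x| ^ 3 := integral_nonneg fun x => by positivity
  have pv : 0 ≤ ∫ x, |v x| ^ 3 := integral_nonneg fun x => by positivity
  have hfin : (√κ - √κ₀) * ((∫ x, |u x| ^ 3) + ∫ x, |v x| ^ 3) ≤ 0 := by
    rw [← hκ_def] at hQ
    linarith
  have hsum : (∫ x, |u x| ^ 3) + ∫ x, |v x| ^ 3 ≤ 0 := by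
    by_contra hc
    exact absurd hfin (not_le.2 (mul_pos (sub_pos.2 hsqrt) (not_le.1 hc)))
  have hzero : ∀ w : E3 → ℝ, Integrable (fun x => |w x| ^ 3) volume → ∫ x, |w x| ^ 3 = 0 →
      w =ᵐ[volume] 0 := by
    intro w hi h0
    have := (integral_eq_zero_iff_of_nonneg (fun x => by positivity) hi).1 h0
    filter_upwards [this] with x hx
    simpa using hx
  exact ⟨hzero u cu (by linarith), hzero v cv (by linarith)⟩

theorem theorem3 (p l m₁₁ m₁₂ m₂₂ : ℝ) (hp₁ : 1 < p) (hp₂ : p ≤ 2) (hl : 0 < l)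
    (hm₁₁ : 0 < m₁₁) (hm₁₂ : 0 < m₁₂) (hm₂₂ : 0 < m₂₂)
    (hdet : (if p < 2 then
        (p - 1) ^ 2 / 4 *
          ((2 : ℝ) ^ p * (2 - p) ^ (2 - p) / l ^ (2 - p)) ^ (2 / (p - 1))
        else 4) < (m₁₁ * m₂₂ - m₁₂ ^ 2) / (m₁₁ + m₂₂))
    (u v : E3 → ℝ) :
    IsSolution p l m₁₁ m₁₂ m₂₂ u v ↔ u =ᵐ[volume] 0 ∧ v =ᵐ[volume] 0 := by
  constructor
  · intro h
    have ⟨_, _, hu, hv, _, _⟩ := h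
    have hum := hu.1.1
    have hvm := hv.1.1
    obtain ⟨h1, h2⟩ := (h.congr hum.ae_eq_mk hvm.ae_eq_mk).ae_eq_zero_of_measurable hp₁ hp₂ hl
      hm₁₁ hm₂₂ hdet hum.stronglyMeasurable_mk.measurable hvm.stronglyMeasurable_mk.measurable
    exact ⟨hum.ae_eq_mk.trans h1, hvm.ae_eq_mk.trans h2⟩
  · rintro ⟨hu, hv⟩
    exact (isSolution_zero p l m₁₁ m₁₂ m₂₂).congr hu.symm hv.symm
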